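/- **Rotation number of the McMillan sextupole.** Let $|a|<2$ and let $$\mathrm H(q,p)=p^2q+p\,q^2+p^2-a\,p\,q+q^2 ,\qquad f(p)=-p\,\frac{p-a}{p+1}.$$ The McMillan sextupole map is $(q,p)\mapsto(q',p')=(p,\,-q+f(p))$; it preserves $\mathrm H$. Let $C$ be a closed invariant curve at a level $\mathrm H=h>0$, i.e. a compact connected component of the level set $\{\mathrm H=h\}\subset\mathbb R^2$. Then: 1. The quartic $$\mathcal P(q)=q^4-2(2+a)q^3+(a^2-4)q^2+4h\,q+4h$$ has four distinct real roots $q_1<q_2<q_3<q_4$, the projection of $C$ to the $q$-axis is exactly $[q_2,q_3]$, and $p\neq-1$ on $C$ (so the map is defined on $C$). 2. $C$ is the range of a periodic solution $\gamma(t)=(q(t),p(t))$, with minimal period $T>0$, of the auxiliary Hamiltonian system $\dot q=\partial\mathrm H/\partial p$, $\dot p=-\partial\mathrm H/\partial q$. One step of the map on $C$ is the time-$T'$ shift along this flow for some $0<T'<T$: the map sends $\gamma(t)$ to $\gamma(t+T')$ for all $t\in\mathbb R$. 3. The Poincaré rotation number $\nu\in[0,1)$ of the map on $C$, with $C$ oriented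 clockwise in the $(q,p)$-plane (equivalently, by the Hamiltonian flow), is $$\nu=\frac{T'}{T}=\frac{\mathrm F\!\left[\arcsin\sqrt{R},\,\kappa\right]}{2\,\mathrm K[\kappa]},$$ where $$R=\frac{q_3-q_1}{q_3-q_2}\cdot\frac{q_2\,(3q_2+2-a)}{2q_1(q_2+1)+q_2(q_2-a)}\in(0,1),\qquad \kappa=\sqrt{\frac{(q_3-q_2)(q_4-q_1)}{(q_3-q_1)(q_4-q_2)}},$$ and $\mathrm F[\phi,\kappa]=\int_0^\phi\frac{d\theta}{\sqrt{1-\kappa^2\sin^2\theta}}$ and $\mathrm K[\kappa]=\mathrm F[\pi/2,\kappa]$ are the incomplete and complete elliptic integrals of the first kind with modulus $\kappa$. -/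

import Mathlib

namespace McMillan

/-- The biquadratic invariant `p² q + p q² + p² - a p q + q²`.
Phase points are pairs `z = (q, p)`: coordinate first, momentum second. -/
def invariant (a : ℝ) (z : ℝ × ℝ) : ℝ :=
  z.2 ^ 2 * z.1 + z.2 * z.1 ^ 2 + z.2 ^ 2 - a * z.2 * z.1 + z.1 ^ 2

/-- The sextupole force function, normalized to `Γ = 1` and `2 ε = -a`. -/
noncomputable def force (a p : ℝ) : ℝ := -p * ((p - a) / (p + 1))

/-- The McMillan sextupole map `q' = p`, `p' = -q + f(p)`; meaningful where `p ≠ -1`. -/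
noncomputable def sextupoleMap (a : ℝ) (z : ℝ × ℝ) : ℝ × ℝ :=
  (z.2, -z.1 + force a z.2)

/-- The quartic `𝓟(q)` at the level `h` of the invariant. -/
def quartic (a h q : ℝ) : ℝ :=
  q ^ 4 - 2 * (2 + a) * q ^ 3 + (a ^ 2 - 4) * q ^ 2 + 4 * h * q + 4 * h

/-- A closed curve at the level `h`: a compact connected component of the level set of the
invariant. (For `|a| < 2` and `h > 0` this is a smooth oval around the origin.) -/
def IsClosedLevelCurve (a h : ℝ) (C : Set (ℝ × ℝ)) : Prop :=
  IsCompact C ∧ ∃ z : ℝ × ℝ, invariant a z = h ∧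
    C = connectedComponentIn {w : ℝ × ℝ | invariant a w = h} z

/-- Hamilton's equations `dq/dt = ∂H/∂p`, `dp/dt = -∂H/∂q`, where `H` is the invariant. -/
def IsHamiltonianTrajectory (a : ℝ) (γ : ℝ → ℝ × ℝ) : Prop :=
  ∀ t : ℝ,
    HasDerivAt (fun s => (γ s).1) (deriv (fun p => invariant a ((γ t).1, p)) (γ t).2) t ∧
    HasDerivAt (fun s => (γ s).2) (-deriv (fun q => invariant a (q, (γ t).2)) (γ t).1) t

/-- `c` is a simple closed parametrization of `C` of period `1`, traversed clockwise in the
`(q, p)`-plane, that is, with `∮ p dq > 0`. -/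
structure IsClockwiseParam (C : Set (ℝ × ℝ)) (c : ℝ → ℝ × ℝ) : Prop where
  contDiff : ContDiff ℝ 1 c
  periodic : Function.Periodic c 1
  injOn : Set.InjOn c (Set.Ico 0 1)
  range_eq : Set.range c = C
  clockwise : 0 < ∫ s in (0 : ℝ)..1, (c s).2 * (deriv c s).1

/-- `ν ∈ [0, 1)` is the Poincaré rotation number, measured clockwise, of the map `M` on the
closed curve `C`: in a clockwise parametrization of `C` by the circle `ℝ / ℤ`, the map `M`
has a continuous lift `F : ℝ → ℝ` with `F (s + 1) = F s + 1` and with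
`lim (F^n s - s) / n = ν`. -/
def HasRotationNumber (M : ℝ × ℝ → ℝ × ℝ) (C : Set (ℝ × ℝ)) (ν : ℝ) : Prop :=
  ν ∈ Set.Ico (0 : ℝ) 1 ∧
    ∃ (c : ℝ → ℝ × ℝ) (F : CircleDeg1Lift), IsClockwiseParam C c ∧ Continuous F ∧
      (∀ s : ℝ, M (c s) = c (F s)) ∧ F.translationNumber = ν

/-- Incomplete elliptic integral of the first kind with modulus `k`. -/
noncomputable def ellipticF (φ k : ℝ) : ℝ :=
  ∫ θ in (0 : ℝ)..φ, 1 / Real.sqrt (1 - k ^ 2 * Real.sin θ ^ 2)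

/-- Complete elliptic integral of the first kind with modulus `k`. -/
noncomputable def ellipticK (k : ℝ) : ℝ := ellipticF (Real.pi / 2) k

/-- The elliptic modulus `κ` in terms of the roots of the quartic. -/
noncomputable def modulus (q₁ q₂ q₃ q₄ : ℝ) : ℝ :=
  Real.sqrt (((q₃ - q₂) * (q₄ - q₁)) / ((q₃ - q₁) * (q₄ - q₂)))

/-- The quantity under the square root in the argument of the elliptic integral. -/
noncomputable def radicand (a q₁ q₂ q₃ : ℝ) : ℝ :=
  (q₃ - q₁) / (q₃ - q₂) *
    (q₂ * (3 * q₂ + 2 - a) / (2 * q₁ * (q₂ + 1) + q₂ * (q₂ - a)))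

end McMillan

/-! On the level set `H = h`, viewed as a quadratic equation in `p`, the discriminant is the quartic
`𝓟(q)` and `(∂H/∂p)² = 𝓟(q)`. Along the flow `u = dq/dt` therefore satisfies `u² = 𝓟(q)`, an
elliptic equation.

Compactness of `C` is exploited in the coordinates `q + p` and `p - q`, where the level set consists
of two sheets over the sum. A sheet that cannot turn back escapes to infinity or reaches the line `q
+ p = 2 + a`, so `C` lies below the critical levels `(2 + a)²` and `(2 - a)³ / 27` and meets the
antidiagonal (`exists_antidiagonal_mem_of_isCompact`). Below these levels sign changes produce four
roots, none below `-1` (`exists_isRootSystem`), and `C` is the part of the level set over `[q₂,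
q₃]`, symmetric under `q ↔ p` (`exists_root_system_of_isClosedLevelCurve`). Symmetry puts `p` in
`[q₂, q₃]` as well, away from `-1`.

The Möbius substitution `sin² θ = (q₃ - q₁)(q - q₂) / ((q₃ - q₂)(q - q₁))`, with `θ` the Jacobi
amplitude of `ω t`, gives an explicit solution with minimal period `2K/ω` (`hasDerivAt_orbit`,
`isLeast_period`).

The map carries Hamiltonian trajectories on `C` to Hamiltonian trajectories on `C`, so by uniqueness
it is a time shift, fixed by the image of one point. The leftmost point `(q₂, p₀)` goes to a point
with coordinate `p₀` and `u > 0`, that is, to `θ = arcsin √R` (`orbitPhase_arcsin`). Hence `T' =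
F/ω`, and in the time parametrization the lift of the map is translation by `T'/T`. -/

open Set

namespace McMillan

/-! ### Compact components in sum and difference coordinates -/

/-- The level set of the invariant. -/
def levelSet (a h : ℝ) : Set (ℝ × ℝ) := {w | invariant a w = h}

/-- The cubic whose sign governs the level set in the coordinate `s = q + p`. -/
def sumCubic (a h s : ℝ) : ℝ := 4 * h - (2 - a) * s ^ 2 - s ^ 3

theorem four_mul_invariant_sub (a h : ℝ) (z : ℝ × ℝ) :
    4 * (invariant a z - h) =
      (z.2 - z.1) ^ 2 * (2 + a - (z.1 + z.2)) - sumCubic a h (z.1 + z.2) := by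
  simp only [invariant, sumCubic]; ring

theorem mem_levelSet_iff {a h : ℝ} {z : ℝ × ℝ} :
    z ∈ levelSet a h ↔
      (z.2 - z.1) ^ 2 * (2 + a - (z.1 + z.2)) = sumCubic a h (z.1 + z.2) := by
  have := four_mul_invariant_sub a h z
  simp only [levelSet, mem_ofPred_eq]
  constructor <;> intro H <;> linarith

/-- The point of the level set with coordinate sum `s`, on the sheet selected by the sign `e`. -/
noncomputable def sheet (a h e s : ℝ) : ℝ × ℝ :=
  ((s - e * √(sumCubic a h s / (2 + a - s))) / 2, (s + e * √(sumCubic a h s / (2 + a - s))) / 2)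

theorem sheet_sum (a h e s : ℝ) : (sheet a h e s).1 + (sheet a h e s).2 = s := by
  simp only [sheet]; ring

theorem sheet_mem {a h e s : ℝ} (he : e ^ 2 = 1) (hs : s ≠ 2 + a)
    (hN : 0 ≤ sumCubic a h s / (2 + a - s)) : sheet a h e s ∈ levelSet a h := by
  rw [mem_levelSet_iff, sheet_sum]
  have h1 : (sheet a h e s).2 - (sheet a h e s).1 = e * √(sumCubic a h s / (2 + a - s)) := by
    simp only [sheet]; ring
  have h2 : 2 + a - s ≠ 0 := fun h0 => hs (by linarith)
  rw [h1, mul_pow, he, Real.sq_sqrt hN]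
  field_simp

theorem exists_sheet_eq {a h : ℝ} {z : ℝ × ℝ} (hz : z ∈ levelSet a h)
    (hs : z.1 + z.2 ≠ 2 + a) :
    0 ≤ sumCubic a h (z.1 + z.2) / (2 + a - (z.1 + z.2)) ∧
      ∃ e : ℝ, (e = 1 ∨ e = -1) ∧ sheet a h e (z.1 + z.2) = z := by
  rw [mem_levelSet_iff] at hz
  have h2 : 2 + a - (z.1 + z.2) ≠ 0 := fun h0 => hs (by linarith)
  have h3 : sumCubic a h (z.1 + z.2) / (2 + a - (z.1 + z.2)) = (z.2 - z.1) ^ 2 := by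
    rw [← hz]; field_simp
  refine ⟨h3 ▸ sq_nonneg _, ?_⟩
  rcases le_total 0 (z.2 - z.1) with h4 | h4
  · refine ⟨1, Or.inl rfl, ?_⟩
    simp only [sheet, h3, Real.sqrt_sq_eq_abs, abs_of_nonneg h4]
    ext <;> simp only <;> ring
  · refine ⟨-1, Or.inr rfl, ?_⟩
    simp only [sheet, h3, Real.sqrt_sq_eq_abs, abs_of_nonpos h4]
    ext <;> simp only <;> ring

theorem continuousOn_sheet (a h e : ℝ) {I : Set ℝ} (hI : ∀ s ∈ I, s ≠ 2 + a) :
    ContinuousOn (sheet a h e) I := by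
  have h1 : ContinuousOn (fun s => sumCubic a h s / (2 + a - s)) I := by
    apply ContinuousOn.div
    · unfold sumCubic; fun_prop
    · fun_prop
    · intro s hs h0; exact hI s hs (by linarith)
  unfold sheet
  have h2 := h1.sqrt
  fun_prop

/-- A sheet over an interval stays in the component of each of its points. -/
theorem sheet_mem_component {a h e s₀ : ℝ} {I : Set ℝ} {z : ℝ × ℝ} (he : e = 1 ∨ e = -1)
    (hI : I.OrdConnected) (hs₀ : s₀ ∈ I) (hz : sheet a h e s₀ = z)
    (hne : ∀ s ∈ I, s ≠ 2 + a) (hN : ∀ s ∈ I, 0 ≤ sumCubic a h s / (2 + a - s)) :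
    ∀ s ∈ I, sheet a h e s ∈ connectedComponentIn (levelSet a h) z := by
  have he2 : e ^ 2 = 1 := by rcases he with rfl | rfl <;> norm_num
  have h1 : IsPreconnected (sheet a h e '' I) :=
    hI.isPreconnected.image _ (continuousOn_sheet a h e hne)
  have h2 := h1.subset_connectedComponentIn (F := levelSet a h) (x := z) ⟨s₀, hs₀, hz⟩ (by
    rintro _ ⟨s, hs, rfl⟩
    exact sheet_mem he2 (hne s hs) (hN s hs))
  exact fun s hs => h2 ⟨s, hs, rfl⟩

theorem sumCubic_antitone {a h : ℝ} (ha : |a| < 2) {s t : ℝ} (hs : 0 ≤ s) (hst : s ≤ t) :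
    sumCubic a h t ≤ sumCubic a h s := by
  have := abs_lt.1 ha
  have h1 : s ^ 2 ≤ t ^ 2 := by gcongr
  have h2 : s ^ 3 ≤ t ^ 3 := by gcongr
  simp only [sumCubic]
  nlinarith

/-- A negative value at `s` would force three negative roots, with multiplicity. The cubic has no
linear term, so the pairwise products of its roots sum to zero, which rules this out. The divided
differences `e1`, `e2`, `e3` express this without naming the roots. -/
theorem sumCubic_nonneg_of_between {a h : ℝ} {s' s₀ s : ℝ}
    (h1 : s' < s₀) (h2 : s₀ ≤ s) (h3 : s ≤ 0) (hh : 0 < h)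
    (hs' : sumCubic a h s' < 0) (hs₀ : 0 ≤ sumCubic a h s₀) : 0 ≤ sumCubic a h s := by
  by_contra! hs
  have h2' : s₀ < s := lt_of_le_of_ne h2 (by rintro rfl; linarith)
  have h3' : s < 0 := lt_of_le_of_ne h3 (by rintro rfl; simp [sumCubic] at hs; linarith)
  set c := 2 - a with hc
  simp only [sumCubic, ← hc] at *
  have e1 : 0 < c * (s + s₀) + s ^ 2 + s * s₀ + s₀ ^ 2 := by
    by_contra! h0
    nlinarith [mul_nonneg (sub_pos.2 h2').le (neg_nonneg.2 h0)]
  have e2 : c * (s' + s₀) + s' ^ 2 + s' * s₀ + s₀ ^ 2 < 0 := by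
    by_contra! h0
    nlinarith [mul_nonneg (sub_pos.2 h1).le h0]
  have e3 : 0 < c + s + s' + s₀ := by
    by_contra! h0
    nlinarith [mul_nonneg (sub_pos.2 (h1.trans h2')).le (neg_nonneg.2 h0)]
  have p1 : 0 < s' * s := mul_pos_of_neg_of_neg (by linarith) h3'
  have p2 : 0 < s' * s₀ := mul_pos_of_neg_of_neg (by linarith) (by linarith)
  have p3 : 0 < s * s₀ := mul_pos_of_neg_of_neg (by linarith) (by linarith)
  nlinarith [mul_pos e3 (show 0 < -(s + s₀) by linarith)]

/-- One point with sum `2 + a` forces `sumCubic a h (2 + a) = 0`; the whole line `q + p = 2 + a`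
then lies in the level set and makes the component unbounded. -/
theorem sum_ne_of_isCompact {a h : ℝ} {z w : ℝ × ℝ}
    (hC : IsCompact (connectedComponentIn (levelSet a h) z))
    (hw : w ∈ connectedComponentIn (levelSet a h) z) : w.1 + w.2 ≠ 2 + a := by
  intro hs
  have hwl := connectedComponentIn_subset _ _ hw
  have hN : sumCubic a h (2 + a) = 0 := by
    rw [mem_levelSet_iff, hs] at hwl; rw [← hwl]; ring
  rw [connectedComponentIn_eq hw] at hC
  have h1 : IsPreconnected (range fun x : ℝ => (x, 2 + a - x)) :=
    isPreconnected_range (by fun_prop)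
  have h2 := h1.subset_connectedComponentIn (F := levelSet a h) (x := w)
    ⟨w.1, by ext <;> simp only; linarith⟩ (by
      rintro _ ⟨x, rfl⟩
      rw [mem_levelSet_iff]
      simp [hN])
  obtain ⟨b, hb⟩ := (hC.image continuous_fst).bddAbove
  have := hb ⟨_, h2 ⟨b + 1, rfl⟩, rfl⟩
  simp only at this
  linarith

/-- A compact component of a positive level set lies below both critical levels and passes
through a point of the antidiagonal. -/
theorem exists_antidiagonal_mem_of_isCompact {a h : ℝ} (ha : |a| < 2) (hh : 0 < h) {z : ℝ × ℝ}
    (hz : z ∈ levelSet a h) (hC : IsCompact (connectedComponentIn (levelSet a h) z)) :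
    h < (2 + a) ^ 2 ∧ 27 * h < (2 - a) ^ 3 ∧ ∃ e : ℝ, (e = 1 ∨ e = -1) ∧
      (-(e * √(h / (2 + a))), e * √(h / (2 + a))) ∈ connectedComponentIn (levelSet a h) z := by
  have ha' := abs_lt.1 ha
  have hzC := mem_connectedComponentIn hz
  have hbdd : IsCompact ((fun w : ℝ × ℝ => w.1 + w.2) ''
      connectedComponentIn (levelSet a h) z) := hC.image (by fun_prop)
  have hne := sum_ne_of_isCompact hC hzC
  obtain ⟨hquot, e, he, hez⟩ := exists_sheet_eq hz hne
  set s₀ := z.1 + z.2 with hs₀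
  have hsum : ∀ s, sheet a h e s ∈ connectedComponentIn (levelSet a h) z →
      s ∈ (fun w : ℝ × ℝ => w.1 + w.2) '' connectedComponentIn (levelSet a h) z :=
    fun s hs => ⟨_, hs, sheet_sum a h e s⟩
  -- Beyond `2 + a` the cubic only decreases, so the sheet would continue to arbitrarily large sums.
  have hlt : s₀ < 2 + a := by
    by_contra! h0
    have h1 : 2 + a < s₀ := lt_of_le_of_ne h0 (Ne.symm hne)
    have hN₀ : sumCubic a h s₀ ≤ 0 := by
      by_contra! hpos
      exact absurd hquot (not_le.2 (div_neg_of_pos_of_neg hpos (by linarith)))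
    have h2 := sheet_mem_component he ordConnected_Ici self_mem_Ici hez
      (fun s hs => by have := mem_Ici.1 hs; linarith [this] |> ne_of_gt)
      (fun s hs => div_nonneg_of_nonpos
        ((sumCubic_antitone ha (by linarith) (mem_Ici.1 hs)).trans hN₀)
        (by have := mem_Ici.1 hs; linarith))
    obtain ⟨b, hb⟩ := hbdd.bddAbove
    have := hb (hsum _ (h2 (max s₀ b + 1) (by simp only [mem_Ici]; linarith [le_max_left s₀ b])))
    linarith [le_max_right s₀ b]
  have hN₀ : 0 ≤ sumCubic a h s₀ := by
    by_contra! hneg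
    exact absurd hquot (not_le.2 (div_neg_of_neg_of_pos hneg (by linarith)))
  -- Otherwise the sheet extends over all of `Iic s₀`.
  obtain ⟨s', hs', hN'⟩ : ∃ s' < s₀, sumCubic a h s' < 0 := by
    by_contra! hall
    have h2 := sheet_mem_component (I := Iic s₀) he ordConnected_Iic self_mem_Iic hez
      (fun s hs => ne_of_lt (lt_of_le_of_lt hs hlt))
      (fun s hs => div_nonneg (by
        rcases eq_or_lt_of_le (mem_Iic.1 hs) with rfl | h1
        · exact hN₀
        · exact hall s h1) (by have := mem_Iic.1 hs; linarith))
    obtain ⟨b, hb⟩ := hbdd.bddBelow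
    have := hb (hsum _ (h2 (min s₀ b - 1) (by simp only [mem_Iic]; linarith [min_le_left s₀ b])))
    linarith [min_le_right s₀ b]
  have hs'0 : s' < 0 := by
    by_contra! h0
    linarith [sumCubic_antitone (h := h) ha h0 hs'.le]
  have hneg : ∀ s, s₀ ≤ s → s ≤ 0 → 0 ≤ sumCubic a h s := fun s h1 h2 =>
    sumCubic_nonneg_of_between hs' h1 h2 hh hN' hN₀
  have hN0 : 0 ≤ sumCubic a h 0 := by simp [sumCubic]; linarith
  refine ⟨?_, ?_, e, he, ?_⟩
  -- If `h ≥ (2 + a)²`, the cubic is nonnegative up to `2 + a`; the sheet covers `Ico s₀ (2 + a)`,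
  -- and closedness of the set of sums adds the forbidden endpoint.
  · by_contra! h0
    have hNσ : 0 ≤ sumCubic a h (2 + a) := by simp only [sumCubic]; nlinarith
    have h2 := sheet_mem_component (I := Ico s₀ (2 + a)) he ordConnected_Ico ⟨le_rfl, hlt⟩ hez
      (fun s hs => ne_of_lt hs.2)
      (fun s hs => div_nonneg (by
        rcases le_total s 0 with h1 | h1
        · exact hneg s hs.1 h1
        · exact hNσ.trans (sumCubic_antitone ha h1 hs.2.le)) (by linarith [hs.2]))
    have h3 : Icc s₀ (2 + a) ⊆ (fun w : ℝ × ℝ => w.1 + w.2) ''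
        connectedComponentIn (levelSet a h) z := by
      rw [← closure_Ico hlt.ne]
      exact closure_minimal (fun s hs => hsum s (h2 s hs)) hbdd.isClosed
    obtain ⟨w, hw, hws⟩ := h3 ⟨hlt.le, le_rfl⟩
    exact sum_ne_of_isCompact hC hw hws
  -- On `s ≤ 0` the maximum of `(2 - a) s² + s³` is `4 (2 - a)³ / 27`, at `s = -2 (2 - a) / 3`; the
  -- hint is the factored gap, times 27.
  · simp only [sumCubic] at hN'
    nlinarith [mul_nonneg (sq_nonneg (3 * s' + 2 * (2 - a))) (show 0 ≤ 2 - a - 3 * s' by linarith)]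
  · have h2 := sheet_mem_component (I := uIcc s₀ 0) he ordConnected_uIcc left_mem_uIcc hez
      (fun s hs => by
        have := hs.2
        exact ne_of_lt (lt_of_le_of_lt this (max_lt hlt (by linarith))))
      (fun s hs => div_nonneg (by
        rcases le_total s₀ 0 with h1 | h1
        · rw [uIcc_of_le h1] at hs; exact hneg s hs.1 hs.2
        · rw [uIcc_of_ge h1] at hs
          exact hN₀.trans (sumCubic_antitone ha hs.1 hs.2)) (by
        have : s ≤ max s₀ 0 := hs.2
        have : max s₀ 0 < 2 + a := max_lt hlt (by linarith)
        linarith)) 0 right_mem_uIcc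
    have h3 : √(sumCubic a h 0 / (2 + a - 0)) = 2 * √(h / (2 + a)) := by
      have : sumCubic a h 0 / (2 + a - 0) = 2 ^ 2 * (h / (2 + a)) := by
        simp only [sumCubic]; ring
      rw [this, Real.sqrt_mul (by norm_num), Real.sqrt_sq (by norm_num)]
    convert h2 using 1
    simp only [sheet, h3]
    ext <;> simp only <;> ring

/-! ### The quartic as a discriminant, and its four roots -/

/-- The partial derivative of the invariant in the momentum. -/
def momentumPartial (a : ℝ) (z : ℝ × ℝ) : ℝ := 2 * z.2 * (z.1 + 1) + z.1 ^ 2 - a * z.1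

/-- The partial derivative of the invariant in the coordinate. -/
def coordinatePartial (a : ℝ) (z : ℝ × ℝ) : ℝ := 2 * z.1 * (z.2 + 1) + z.2 ^ 2 - a * z.2

theorem momentumPartial_sq (a h : ℝ) (z : ℝ × ℝ) :
    momentumPartial a z ^ 2 = quartic a h z.1 + 4 * (z.1 + 1) * (invariant a z - h) := by
  simp only [momentumPartial, quartic, invariant]; ring

theorem momentumPartial_sq_of_mem {a h : ℝ} {z : ℝ × ℝ} (hz : z ∈ levelSet a h) :
    momentumPartial a z ^ 2 = quartic a h z.1 := by
  rw [momentumPartial_sq a h, show invariant a z = h from hz]; ring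

theorem mem_levelSet_of_momentumPartial_sq {a h : ℝ} {z : ℝ × ℝ} (hz : z.1 ≠ -1)
    (H : momentumPartial a z ^ 2 = quartic a h z.1) : z ∈ levelSet a h := by
  rw [momentumPartial_sq a h] at H
  have h1 : z.1 + 1 ≠ 0 := fun h0 => hz (by linarith)
  have h2 : 4 * (z.1 + 1) * (invariant a z - h) = 0 := by linarith
  have h3 : invariant a z - h = 0 := by
    rcases mul_eq_zero.1 h2 with h4 | h4
    · exact absurd h4 (by positivity)
    · exact h4
  exact sub_eq_zero.1 h3

theorem quartic_nonneg_of_mem {a h : ℝ} {z : ℝ × ℝ} (hz : z ∈ levelSet a h) :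
    0 ≤ quartic a h z.1 := momentumPartial_sq_of_mem hz ▸ sq_nonneg _

/-- The roots of the quartic, in increasing order, with none of them below `-1`. -/
structure IsRootSystem (a h q₁ q₂ q₃ q₄ : ℝ) : Prop where
  neg_one_le : -1 ≤ q₁
  lt₁₂ : q₁ < q₂
  lt₂₃ : q₂ < q₃
  lt₃₄ : q₃ < q₄
  factor : ∀ x, quartic a h x = (x - q₁) * (x - q₂) * (x - q₃) * (x - q₄)

/-- Newton interpolation: `D`, `E` and `hb` are the first, second and third divided differences at
the roots, all zero. -/
theorem monic_quartic_factor {b c d e x₁ x₂ x₃ x₄ : ℝ} (h₁₂ : x₁ < x₂) (h₂₃ : x₂ < x₃)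
    (h₃₄ : x₃ < x₄)
    (H₁ : x₁ ^ 4 + b * x₁ ^ 3 + c * x₁ ^ 2 + d * x₁ + e = 0)
    (H₂ : x₂ ^ 4 + b * x₂ ^ 3 + c * x₂ ^ 2 + d * x₂ + e = 0)
    (H₃ : x₃ ^ 4 + b * x₃ ^ 3 + c * x₃ ^ 2 + d * x₃ + e = 0)
    (H₄ : x₄ ^ 4 + b * x₄ ^ 3 + c * x₄ ^ 2 + d * x₄ + e = 0) (x : ℝ) :
    x ^ 4 + b * x ^ 3 + c * x ^ 2 + d * x + e = (x - x₁) * (x - x₂) * (x - x₃) * (x - x₄) := by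
  have D : ∀ y, x₁ < y → y ^ 4 + b * y ^ 3 + c * y ^ 2 + d * y + e = 0 →
      x₁ ^ 3 + x₁ ^ 2 * y + x₁ * y ^ 2 + y ^ 3 + b * (x₁ ^ 2 + x₁ * y + y ^ 2) + c * (x₁ + y) + d
        = 0 := fun y hy Hy =>
    mul_left_cancel₀ (sub_pos.2 hy).ne' (by linear_combination Hy - H₁)
  have E : ∀ y, x₂ < y → y ^ 4 + b * y ^ 3 + c * y ^ 2 + d * y + e = 0 →
      x₁ ^ 2 + x₂ ^ 2 + y ^ 2 + x₁ * x₂ + x₁ * y + x₂ * y + b * (x₁ + x₂ + y) + c = 0 :=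
    fun y hy Hy => mul_left_cancel₀ (sub_pos.2 hy).ne' (by
      linear_combination D y (h₁₂.trans hy) Hy - D x₂ h₁₂ H₂)
  have hb : x₁ + x₂ + x₃ + x₄ + b = 0 := mul_left_cancel₀ (sub_pos.2 h₃₄).ne' (by
      linear_combination E x₄ (h₂₃.trans h₃₄) H₄ - E x₃ h₂₃ H₃)
  have hb' : b = -(x₁ + x₂ + x₃ + x₄) := by linarith
  have hc := E x₃ h₂₃ H₃
  have hd := D x₂ h₁₂ H₂
  subst hb'
  linear_combination H₁ + (x - x₁) * hd + (x - x₁) * (x - x₂) * hc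

theorem continuous_quartic (a h : ℝ) : Continuous (quartic a h) := by
  unfold quartic; fun_prop

theorem antidiagonal_mem {a h e : ℝ} (ha : |a| < 2) (hh : 0 < h) (he : e = 1 ∨ e = -1) :
    (-(e * √(h / (2 + a))), e * √(h / (2 + a))) ∈ levelSet a h := by
  have := abs_lt.1 ha
  have h1 : √(h / (2 + a)) ^ 2 * (2 + a) = h := by
    rw [Real.sq_sqrt (div_nonneg hh.le (by linarith)), div_mul_cancel₀ _ (by linarith)]
  change invariant a _ = h
  simp only [invariant]
  rcases he with rfl | rfl <;> linear_combination h1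

/-- At the critical level `(2 + a)²` the quartic is the square of `x² - (2 + a) x - 2 (2 + a)`. At
the roots of that quadratic it is therefore negative for smaller `h`, as long as `x > -1`. -/
theorem quartic_of_sq_eq {a x : ℝ} (h : ℝ) (hx : x ^ 2 = (2 + a) * x + 2 * (2 + a)) :
    quartic a h x = 4 * (x + 1) * (h - (2 + a) ^ 2) := by
  simp only [quartic]
  linear_combination (x ^ 2 - (2 + a) * x - 2 * (2 + a)) * hx

/-- The quartic takes a negative value to the left of the antidiagonal points. -/
theorem exists_quartic_neg_left {a h : ℝ} (ha : |a| < 2) (hh : 0 < h) (h₁ : h < (2 + a) ^ 2)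
    (h₂ : 27 * h < (2 - a) ^ 3) :
    ∃ x, -1 < x ∧ x < -√(h / (2 + a)) ∧ quartic a h x < 0 := by
  obtain ⟨ha1, ha2⟩ := abs_lt.1 ha
  have hσ : 0 < 2 + a := by linarith
  have key : ∀ x y : ℝ, 0 ≤ y → h / (2 + a) < y ^ 2 → x ≤ -y → x < -√(h / (2 + a)) :=
    fun x y hy h1 h2 => by
      have := (Real.sqrt_lt' (lt_of_le_of_ne hy (by
        rintro rfl
        have : 0 < h / (2 + a) := by positivity
        simp at h1; linarith))).2 h1
      linarith
  -- For `a < -1` the witness is the smaller root of the quadratic in `quartic_of_sq_eq`, which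
  -- exceeds `-1` exactly then. For `a > -1` it is `(a - 2) / 3`, the coordinate of the critical
  -- point on the diagonal at level `(2 - a)³ / 27`.
  rcases lt_trichotomy a (-1) with h3 | rfl | h3
  · set w := √((2 + a) ^ 2 + 8 * (2 + a)) with hw
    have hw2 : w ^ 2 = (2 + a) ^ 2 + 8 * (2 + a) := Real.sq_sqrt (by positivity)
    have hw0 : 0 ≤ w := Real.sqrt_nonneg _
    have hr : √(2 + a) ^ 2 = 2 + a := Real.sq_sqrt hσ.le
    have hr1 : √(2 + a) < 1 := (Real.sqrt_lt' one_pos).2 (by linarith)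
    have hr0 : 0 < √(2 + a) := Real.sqrt_pos.2 hσ
    have hwlt : w < 2 + a + 2 := by
      rw [hw, Real.sqrt_lt' (by linarith)]; nlinarith
    have hwgt : 2 + a + 2 * √(2 + a) < w := by
      rw [hw, Real.lt_sqrt (by positivity)]
      nlinarith [mul_pos hσ (sub_pos.2 hr1)]
    refine ⟨(2 + a - w) / 2, by linarith, key _ (√(2 + a)) hr0.le ?_ (by linarith), ?_⟩
    · rw [hr, div_lt_iff₀ hσ]; nlinarith
    · have hx : 0 < (2 + a - w) / 2 + 1 := by linarith
      rw [quartic_of_sq_eq h (by linear_combination hw2 / 4)]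
      exact mul_neg_of_pos_of_neg (by linarith) (by linarith)
  -- Here both critical levels equal `1` and both witnesses collapse to `-1`, a root of the quartic
  -- with slope `4 (h - 1) < 0`; the witness moves right by `(1 - h) / 3`.
  · norm_num at h₁ h₂
    have hr : √(h / (2 + -1)) ^ 2 = h := by
      rw [Real.sq_sqrt (by positivity)]; norm_num
    set r := √(h / (2 + -1))
    have hr0 : 0 ≤ r := Real.sqrt_nonneg _
    have hr1 : r < 1 := by nlinarith
    refine ⟨-1 + (1 - h) / 3, by linarith,
      by nlinarith [mul_pos (sub_pos.2 hr1) (show 0 < 2 - r by linarith)], ?_⟩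
    simp only [quartic]
    set t := (1 - h) / 3 with ht
    have hh' : h = 1 - 3 * t := by linarith
    have ht0 : 0 < t := by linarith
    have ht1 : t < 1 / 3 := by linarith
    rw [hh']
    nlinarith [mul_pos ht0 ht0, mul_pos (mul_pos ht0 ht0) ht0,
      mul_pos (mul_pos ht0 ht0) (sub_pos.2 ht1), mul_pos (mul_pos (mul_pos ht0 ht0) ht0) (sub_pos.2 ht1)]
  · refine ⟨(a - 2) / 3, by linarith, key _ ((2 - a) / 3) (by linarith) ?_ (by linarith), ?_⟩
    · rw [div_lt_iff₀ hσ]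
      nlinarith [mul_pos (pow_pos (sub_pos.2 ha2) 2) (show 0 < a + 1 by linarith)]
    · have : quartic a h ((a - 2) / 3) = 4 * ((a - 2) / 3 + 1) * (h - (2 - a) ^ 3 / 27) := by
        simp only [quartic]; ring
      rw [this]
      exact mul_neg_of_pos_of_neg (by linarith) (by linarith)

/-- The quartic takes a negative value to the right of the antidiagonal points. -/
theorem exists_quartic_neg_right {a h : ℝ} (ha : |a| < 2) (h₁ : h < (2 + a) ^ 2) :
    ∃ x, √(h / (2 + a)) < x ∧ quartic a h x < 0 := by
  obtain ⟨ha1, ha2⟩ := abs_lt.1 ha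
  have hσ : 0 < 2 + a := by linarith
  set w := √((2 + a) ^ 2 + 8 * (2 + a)) with hw
  have hw2 : w ^ 2 = (2 + a) ^ 2 + 8 * (2 + a) := Real.sq_sqrt (by positivity)
  have hw0 : 0 ≤ w := Real.sqrt_nonneg _
  refine ⟨(2 + a + w) / 2, ?_, ?_⟩
  · rw [Real.sqrt_lt' (by positivity), div_lt_iff₀ hσ]
    nlinarith [mul_nonneg hσ.le hw0]
  · rw [quartic_of_sq_eq h (by linear_combination hw2 / 4)]
    exact mul_neg_of_pos_of_neg (by positivity) (by linarith)

theorem exists_isRootSystem {a h : ℝ} (ha : |a| < 2) (hh : 0 < h) (h₁ : h < (2 + a) ^ 2)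
    (h₂ : 27 * h < (2 - a) ^ 3) :
    ∃ q₁ q₂ q₃ q₄, IsRootSystem a h q₁ q₂ q₃ q₄ ∧
      q₂ ≤ -√(h / (2 + a)) ∧ √(h / (2 + a)) ≤ q₃ := by
  obtain ⟨x, hx1, hxr, hx⟩ := exists_quartic_neg_left ha hh h₁ h₂
  obtain ⟨y, hyr, hy⟩ := exists_quartic_neg_right ha h₁
  have hc := continuous_quartic a h
  have hr0 : 0 ≤ √(h / (2 + a)) := Real.sqrt_nonneg _
  have hσ : 0 < 2 + a := by linarith [(abs_lt.1 ha).1]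
  have hrpos : 0 < √(h / (2 + a)) := Real.sqrt_pos.2 (by positivity)
  -- Signs at `-1 < x < -r < r < y < Y` with `r = √(h / (2 + a))`: `≥ 0`, `< 0`, `≥ 0`, `≥ 0`, `<
  -- 0`, `≥ 0`. At `±r` the sign is free, since these are coordinates of points of the level set.
  have hm1 : 0 ≤ quartic a h (-1) := by
    have : quartic a h (-1) = (1 + a) ^ 2 := by simp only [quartic]; ring
    rw [this]; positivity
  have hrm : 0 ≤ quartic a h (-√(h / (2 + a))) := by
    simpa using quartic_nonneg_of_mem (antidiagonal_mem ha hh (Or.inl rfl))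
  have hrp : 0 ≤ quartic a h (√(h / (2 + a))) := by
    simpa using quartic_nonneg_of_mem (antidiagonal_mem ha hh (Or.inr rfl))
  obtain ⟨Y, hyY, hY⟩ : ∃ Y, y < Y ∧ 0 ≤ quartic a h Y := by
    refine ⟨max y 8 + 1, by linarith [le_max_left y 8], ?_⟩
    set Y := max y 8 + 1
    have hY : 8 < Y := by linarith [le_max_right y 8]
    have e : quartic a h Y = Y ^ 3 * (Y - 2 * (2 + a)) + (a ^ 2 - 4) * Y ^ 2 + 4 * h * (Y + 1) := by
      simp only [quartic]; ring
    rw [e]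
    have e1 : Y ^ 3 * (Y - 2 * (2 + a)) + (a ^ 2 - 4) * Y ^ 2
        = Y ^ 2 * ((Y - 2 - a) ^ 2 - (4 * a + 8)) := by ring
    rw [e1]
    have e2 : 0 ≤ (Y - 2 - a) ^ 2 - (4 * a + 8) := by
      have ha2 := (abs_lt.1 ha).2
      nlinarith [mul_pos (show 0 < Y - 2 - a - 4 by linarith)
        (show 0 < Y - 2 - a + 4 by linarith)]
    have e3 : 0 < Y := by linarith
    positivity
  obtain ⟨q₁, ⟨hq1, hq1'⟩, hr1⟩ := intermediate_value_Icc' hx1.le hc.continuousOn ⟨hx.le, hm1⟩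
  obtain ⟨q₂, ⟨hq2, hq2'⟩, hr2⟩ := intermediate_value_Icc hxr.le hc.continuousOn ⟨hx.le, hrm⟩
  obtain ⟨q₃, ⟨hq3, hq3'⟩, hr3⟩ := intermediate_value_Icc' hyr.le hc.continuousOn ⟨hy.le, hrp⟩
  obtain ⟨q₄, ⟨hq4, hq4'⟩, hr4⟩ := intermediate_value_Icc hyY.le hc.continuousOn ⟨hy.le, hY⟩
  have n1 : q₁ ≠ x := by rintro rfl; linarith
  have n3 : q₃ ≠ y := by rintro rfl; linarith
  have l12 : q₁ < q₂ := (lt_of_le_of_ne hq1' n1).trans_le hq2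
  have l23 : q₂ < q₃ := by linarith
  have l34 : q₃ < q₄ := (lt_of_le_of_ne hq3' n3).trans_le hq4
  refine ⟨q₁, q₂, q₃, q₄, ⟨hq1, l12, l23, l34, fun t => ?_⟩, hq2', hq3⟩
  have := monic_quartic_factor (b := -2 * (2 + a)) (c := a ^ 2 - 4) (d := 4 * h) (e := 4 * h)
    l12 l23 l34 (by rw [← hr1, quartic]; ring) (by rw [← hr2, quartic]; ring)
    (by rw [← hr3, quartic]; ring) (by rw [← hr4, quartic]; ring) t
  rw [← this, quartic]; ring

/-! ### Elliptic integral of the first kind and its inverse, the Jacobi amplitude -/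

section Amplitude

variable {k : ℝ}

/-- The Legendre radical `√(1 - k² sin² θ)`. -/
noncomputable def legendreRadical (k θ : ℝ) : ℝ := √(1 - k ^ 2 * Real.sin θ ^ 2)

theorem legendreRadicand_pos (hk : k ^ 2 < 1) (θ : ℝ) : 0 < 1 - k ^ 2 * Real.sin θ ^ 2 := by
  nlinarith [Real.sin_sq_le_one θ, sq_nonneg k, sq_nonneg (Real.sin θ)]

theorem legendreRadical_pos (hk : k ^ 2 < 1) (θ : ℝ) : 0 < legendreRadical k θ :=
  Real.sqrt_pos.2 (legendreRadicand_pos hk θ)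

theorem legendreRadical_sq (hk : k ^ 2 < 1) (θ : ℝ) :
    legendreRadical k θ ^ 2 = 1 - k ^ 2 * Real.sin θ ^ 2 :=
  Real.sq_sqrt (legendreRadicand_pos hk θ).le

theorem continuous_legendreRadical (k : ℝ) : Continuous (legendreRadical k) := by
  unfold legendreRadical; fun_prop

theorem hasDerivAt_legendreRadical (hk : k ^ 2 < 1) (θ : ℝ) :
    HasDerivAt (legendreRadical k)
      (-(k ^ 2 * Real.sin θ * Real.cos θ) / legendreRadical k θ) θ := by
  have h1 : HasDerivAt (fun x => 1 - k ^ 2 * Real.sin x ^ 2)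
      (-(k ^ 2 * (2 * Real.sin θ * Real.cos θ))) θ := by
    have := (((Real.hasDerivAt_sin θ).pow 2).const_mul (k ^ 2)).const_sub 1
    simpa using this
  have h2 := h1.sqrt (legendreRadicand_pos hk θ).ne'
  have h3 := legendreRadical_pos hk θ
  refine h2.congr_deriv ?_
  rw [show √(1 - k ^ 2 * Real.sin θ ^ 2) = legendreRadical k θ from rfl]
  field_simp

theorem continuous_inv_legendreRadical (hk : k ^ 2 < 1) :
    Continuous fun θ => 1 / legendreRadical k θ :=
  continuous_const.div (continuous_legendreRadical k) fun θ => (legendreRadical_pos hk θ).ne'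

theorem hasDerivAt_ellipticF (hk : k ^ 2 < 1) (φ : ℝ) :
    HasDerivAt (fun φ => ellipticF φ k) (1 / legendreRadical k φ) φ :=
  intervalIntegral.integral_hasDerivAt_right
    ((continuous_inv_legendreRadical hk).intervalIntegrable _ _)
    ((continuous_inv_legendreRadical hk).stronglyMeasurableAtFilter _ _)
    (continuous_inv_legendreRadical hk).continuousAt

theorem ellipticF_strictMono (hk : k ^ 2 < 1) : StrictMono fun φ => ellipticF φ k :=
  strictMono_of_deriv_pos fun φ => by
    rw [(hasDerivAt_ellipticF hk φ).deriv]
    exact one_div_pos.2 (legendreRadical_pos hk φ)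

theorem ellipticF_zero (k : ℝ) : ellipticF 0 k = 0 := by simp [ellipticF]

theorem ellipticF_add_pi (hk : k ^ 2 < 1) (φ : ℝ) :
    ellipticF (φ + Real.pi) k = ellipticF φ k + 2 * ellipticK k := by
  have hint : ∀ x y, IntervalIntegrable (fun θ => 1 / legendreRadical k θ)
    MeasureTheory.volume x y := fun x y =>
      (continuous_inv_legendreRadical hk).intervalIntegrable x y
  have hper : Function.Periodic (fun θ => 1 / legendreRadical k θ) Real.pi := fun θ => by
    simp [legendreRadical, Real.sin_add_pi]
  have h1 : ellipticF (φ + Real.pi) k = ellipticF φ k +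
      ∫ θ in φ..φ + Real.pi, 1 / legendreRadical k θ :=
    (intervalIntegral.integral_add_adjacent_intervals (hint _ _) (hint _ _)).symm
  have h2 : ∫ θ in φ..φ + Real.pi, 1 / legendreRadical k θ =
      ∫ θ in (0 : ℝ)..Real.pi, 1 / legendreRadical k θ := by
    simpa using hper.intervalIntegral_add_eq φ 0
  have h3 : ∫ θ in (0 : ℝ)..Real.pi, 1 / legendreRadical k θ =
      (∫ θ in (0 : ℝ)..Real.pi / 2, 1 / legendreRadical k θ) +
      ∫ θ in Real.pi / 2..Real.pi, 1 / legendreRadical k θ :=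
    (intervalIntegral.integral_add_adjacent_intervals (hint _ _) (hint _ _)).symm
  have h4 : ∫ θ in Real.pi / 2..Real.pi, 1 / legendreRadical k θ =
      ∫ θ in (0 : ℝ)..Real.pi / 2, 1 / legendreRadical k θ := by
    have := intervalIntegral.integral_comp_sub_left (a := 0) (b := Real.pi / 2)
      (fun θ => 1 / legendreRadical k θ) Real.pi
    rw [sub_zero, show Real.pi - Real.pi / 2 = Real.pi / 2 by ring] at this
    rw [← this]
    simp [legendreRadical, Real.sin_pi_sub]
  have h5 : ∫ θ in (0 : ℝ)..Real.pi / 2, 1 / legendreRadical k θ = ellipticK k := rfl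
  rw [h1, h2, h3, h4, h5]; ring

theorem ellipticK_pos (hk : k ^ 2 < 1) : 0 < ellipticK k := by
  rw [← ellipticF_zero k]
  exact ellipticF_strictMono hk (by positivity)

theorem ellipticF_surjective (hk : k ^ 2 < 1) : Function.Surjective fun φ => ellipticF φ k := by
  have hK := ellipticK_pos hk
  have hcont : Continuous fun φ => ellipticF φ k :=
    continuous_iff_continuousAt.2 fun φ => (hasDerivAt_ellipticF hk φ).continuousAt
  have hmul : ∀ n : ℕ, ellipticF (n * Real.pi) k = n * (2 * ellipticK k) := fun n => by
    induction n with
    | zero => simp [ellipticF_zero]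
    | succ n ih =>
      rw [show ((n + 1 : ℕ) : ℝ) * Real.pi = n * Real.pi + Real.pi by push_cast; ring,
        ellipticF_add_pi hk, ih]
      push_cast; ring
  have hmul' : ∀ n : ℕ, ellipticF (-(n * Real.pi)) k = -(n * (2 * ellipticK k)) := fun n => by
    induction n with
    | zero => simp [ellipticF_zero]
    | succ n ih =>
      have := ellipticF_add_pi hk (-((n + 1 : ℕ) * Real.pi))
      rw [show -(((n + 1 : ℕ) : ℝ) * Real.pi) + Real.pi = -(n * Real.pi) by push_cast; ring,
        ih] at this
      push_cast at this ⊢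
      linarith
  intro t
  obtain ⟨n, hn⟩ := exists_nat_ge (|t| / (2 * ellipticK k))
  rw [div_le_iff₀ (by positivity)] at hn
  have hpi : 0 ≤ (n : ℝ) * Real.pi := by positivity
  obtain ⟨φ, -, hφ⟩ := intermediate_value_Icc (show -(n * Real.pi) ≤ n * Real.pi by linarith)
    hcont.continuousOn (show t ∈ Icc _ _ by
      simp only [hmul, hmul']
      exact abs_le.1 hn)
  exact ⟨φ, hφ⟩

/-- The Jacobi amplitude: the inverse function of `φ ↦ F(φ, k)`. -/
noncomputable def amplitude (k t : ℝ) : ℝ := Function.invFun (fun φ => ellipticF φ k) t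

theorem ellipticF_amplitude (hk : k ^ 2 < 1) (t : ℝ) : ellipticF (amplitude k t) k = t :=
  Function.rightInverse_invFun (ellipticF_surjective hk) t

theorem amplitude_ellipticF (hk : k ^ 2 < 1) (φ : ℝ) : amplitude k (ellipticF φ k) = φ :=
  Function.leftInverse_invFun (ellipticF_strictMono hk).injective φ

theorem amplitude_zero (hk : k ^ 2 < 1) : amplitude k 0 = 0 := by
  conv_lhs => rw [← ellipticF_zero k]
  exact amplitude_ellipticF hk 0

theorem amplitude_strictMono (hk : k ^ 2 < 1) : StrictMono (amplitude k) := fun s t hst => by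
  rw [← (ellipticF_strictMono hk).lt_iff_lt]
  simpa only [ellipticF_amplitude hk] using hst

theorem amplitude_add (hk : k ^ 2 < 1) (t : ℝ) :
    amplitude k (t + 2 * ellipticK k) = amplitude k t + Real.pi := by
  rw [← amplitude_ellipticF hk (amplitude k t + Real.pi), ellipticF_add_pi hk,
    ellipticF_amplitude hk]

theorem continuous_amplitude (hk : k ^ 2 < 1) : Continuous (amplitude k) :=
  (amplitude_strictMono hk).monotone.continuous_of_surjective
    fun φ => ⟨_, amplitude_ellipticF hk φ⟩

theorem hasDerivAt_amplitude (hk : k ^ 2 < 1) (t : ℝ) :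
    HasDerivAt (amplitude k) (legendreRadical k (amplitude k t)) t := by
  have := HasDerivAt.of_local_left_inverse (continuous_amplitude hk).continuousAt
    (hasDerivAt_ellipticF hk (amplitude k t))
    (one_div_pos.2 (legendreRadical_pos hk _)).ne'
    (Filter.Eventually.of_forall (ellipticF_amplitude hk))
  simpa using this

end Amplitude

/-! ### Elliptic parametrization of the coordinate and its velocity -/

section Orbit

variable {a h q₁ q₂ q₃ q₄ : ℝ}

/-- The angular frequency of the elliptic parametrization. -/
noncomputable def frequency (q₁ q₂ q₃ q₄ : ℝ) : ℝ := √((q₃ - q₁) * (q₄ - q₂)) / 2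

/-- The denominator in the elliptic parametrization of the coordinate. -/
noncomputable def orbitDen (q₁ q₂ q₃ θ : ℝ) : ℝ := q₃ - q₁ - (q₃ - q₂) * Real.sin θ ^ 2

/-- The coordinate on the closed curve as a function of the amplitude. -/
noncomputable def orbitCoord (q₁ q₂ q₃ θ : ℝ) : ℝ :=
  (q₂ * (q₃ - q₁) - q₁ * (q₃ - q₂) * Real.sin θ ^ 2) / orbitDen q₁ q₂ q₃ θ

/-- The velocity of the coordinate along the Hamiltonian flow as a function of the amplitude. -/
noncomputable def orbitSpeed (q₁ q₂ q₃ q₄ θ : ℝ) : ℝ :=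
  2 * (q₃ - q₁) * (q₃ - q₂) * (q₂ - q₁) * frequency q₁ q₂ q₃ q₄ *
    (Real.sin θ * Real.cos θ * legendreRadical (modulus q₁ q₂ q₃ q₄) θ) /
      orbitDen q₁ q₂ q₃ θ ^ 2

/-- The phase point with coordinate `q` at which the momentum derivative of the invariant
equals `u`. -/
noncomputable def phasePoint (a q u : ℝ) : ℝ × ℝ := (q, (u - q ^ 2 + a * q) / (2 * (q + 1)))

theorem momentumPartial_phasePoint {q : ℝ} (hq : q ≠ -1) (u : ℝ) :
    momentumPartial a (phasePoint a q u) = u := by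
  have : q + 1 ≠ 0 := fun h0 => hq (by linarith)
  simp only [momentumPartial, phasePoint]
  field_simp
  ring

theorem phasePoint_momentumPartial {z : ℝ × ℝ} (hz : z.1 ≠ -1) :
    phasePoint a z.1 (momentumPartial a z) = z := by
  have : z.1 + 1 ≠ 0 := fun h0 => hz (by linarith)
  simp only [momentumPartial, phasePoint]
  ext <;> simp only
  field_simp
  ring

namespace IsRootSystem

variable (H : IsRootSystem a h q₁ q₂ q₃ q₄)
include H

theorem lt₁₃ : q₁ < q₃ := H.lt₁₂.trans H.lt₂₃

theorem lt₂₄ : q₂ < q₄ := H.lt₂₃.trans H.lt₃₄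

theorem neg_one_lt : -1 < q₂ := H.neg_one_le.trans_lt H.lt₁₂

theorem modulus_sq :
    modulus q₁ q₂ q₃ q₄ ^ 2 = ((q₃ - q₂) * (q₄ - q₁)) / ((q₃ - q₁) * (q₄ - q₂)) := by
  have h1 := sub_pos.2 H.lt₂₃
  have h2 := sub_pos.2 H.lt₁₃
  have h3 := sub_pos.2 H.lt₂₄
  have h4 := sub_pos.2 (H.lt₁₂.trans H.lt₂₄)
  exact Real.sq_sqrt (by positivity)

theorem modulus_sq_lt_one : modulus q₁ q₂ q₃ q₄ ^ 2 < 1 := by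
  rw [H.modulus_sq, div_lt_one (mul_pos (sub_pos.2 H.lt₁₃) (sub_pos.2 H.lt₂₄))]
  nlinarith [mul_pos (sub_pos.2 H.lt₁₂) (sub_pos.2 H.lt₃₄)]

theorem frequency_pos : 0 < frequency q₁ q₂ q₃ q₄ :=
  half_pos (Real.sqrt_pos.2 (mul_pos (sub_pos.2 H.lt₁₃) (sub_pos.2 H.lt₂₄)))

theorem frequency_sq : 4 * frequency q₁ q₂ q₃ q₄ ^ 2 = (q₃ - q₁) * (q₄ - q₂) := by
  rw [frequency, div_pow, Real.sq_sqrt (mul_pos (sub_pos.2 H.lt₁₃) (sub_pos.2 H.lt₂₄)).le]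
  ring

theorem orbitDen_pos (θ : ℝ) : 0 < orbitDen q₁ q₂ q₃ θ := by
  unfold orbitDen
  nlinarith [mul_nonneg (sub_pos.2 H.lt₂₃).le (sub_nonneg.2 (Real.sin_sq_le_one θ)), H.lt₁₂]

theorem orbitCoord_sub₁ (θ : ℝ) :
    orbitCoord q₁ q₂ q₃ θ - q₁ = (q₃ - q₁) * (q₂ - q₁) / orbitDen q₁ q₂ q₃ θ := by
  have := (H.orbitDen_pos θ).ne'
  rw [orbitCoord]; field_simp; rw [orbitDen]; ring

theorem orbitCoord_sub₂ (θ : ℝ) : orbitCoord q₁ q₂ q₃ θ - q₂ =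
    (q₃ - q₂) * (q₂ - q₁) * Real.sin θ ^ 2 / orbitDen q₁ q₂ q₃ θ := by
  have := (H.orbitDen_pos θ).ne'
  rw [orbitCoord]; field_simp; rw [orbitDen]; ring

theorem orbitCoord_sub₃ (θ : ℝ) : orbitCoord q₁ q₂ q₃ θ - q₃ =
    -((q₃ - q₁) * (q₃ - q₂) * Real.cos θ ^ 2) / orbitDen q₁ q₂ q₃ θ := by
  have := (H.orbitDen_pos θ).ne'
  rw [orbitCoord, Real.cos_sq']; field_simp; rw [orbitDen]; ring

theorem orbitCoord_sub₄ (θ : ℝ) : orbitCoord q₁ q₂ q₃ θ - q₄ =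
    -((q₃ - q₁) * (q₄ - q₂) * (1 - modulus q₁ q₂ q₃ q₄ ^ 2 * Real.sin θ ^ 2)) /
      orbitDen q₁ q₂ q₃ θ := by
  have := (H.orbitDen_pos θ).ne'
  have h2 := (sub_pos.2 H.lt₁₃).ne'
  have h3 := (sub_pos.2 H.lt₂₄).ne'
  rw [orbitCoord, H.modulus_sq]; field_simp; rw [orbitDen]; ring

theorem orbitCoord_mem (θ : ℝ) : orbitCoord q₁ q₂ q₃ θ ∈ Icc q₂ q₃ := by
  have h0 := H.orbitDen_pos θ
  have h1 := (sub_pos.2 H.lt₂₃).le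
  have h2 := (sub_pos.2 H.lt₁₃).le
  have h3 := (sub_pos.2 H.lt₁₂).le
  constructor
  · rw [← sub_nonneg, H.orbitCoord_sub₂]; positivity
  · rw [← sub_nonpos, H.orbitCoord_sub₃, neg_div, neg_nonpos]; positivity

theorem orbitCoord_ne (θ : ℝ) : orbitCoord q₁ q₂ q₃ θ ≠ -1 :=
  (H.neg_one_lt.trans_le (H.orbitCoord_mem θ).1).ne'

/-- The four differences `orbitCoord - qᵢ` multiply to a perfect square, so `orbitSpeed` is a smooth
signed root of the quartic that changes sign at the turning points. -/
theorem orbitSpeed_sq (θ : ℝ) :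
    orbitSpeed q₁ q₂ q₃ q₄ θ ^ 2 = quartic a h (orbitCoord q₁ q₂ q₃ θ) := by
  have := (H.orbitDen_pos θ).ne'
  rw [H.factor, H.orbitCoord_sub₁, H.orbitCoord_sub₂, H.orbitCoord_sub₃, H.orbitCoord_sub₄,
    orbitSpeed, div_pow]
  simp only [mul_pow, legendreRadical_sq H.modulus_sq_lt_one]
  field_simp
  linear_combination ((q₃ - q₁) ^ 2 * (q₃ - q₂) ^ 2 * (q₂ - q₁) ^ 2 * Real.sin θ ^ 2 *
    Real.cos θ ^ 2 * (1 - modulus q₁ q₂ q₃ q₄ ^ 2 * Real.sin θ ^ 2)) * H.frequency_sq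

omit H in
theorem hasDerivAt_orbitDen (θ : ℝ) : HasDerivAt (orbitDen q₁ q₂ q₃)
    (-(2 * (q₃ - q₂) * (Real.sin θ * Real.cos θ))) θ := by
  have := ((((Real.hasDerivAt_sin θ).pow 2).const_mul (q₃ - q₂)).const_sub (q₃ - q₁))
  refine this.congr_deriv ?_
  push_cast; ring

theorem hasDerivAt_orbitCoord (θ : ℝ) : HasDerivAt (orbitCoord q₁ q₂ q₃)
    (2 * (q₃ - q₁) * (q₃ - q₂) * (q₂ - q₁) * (Real.sin θ * Real.cos θ) /
      orbitDen q₁ q₂ q₃ θ ^ 2) θ := by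
  have h1 := (H.orbitDen_pos θ).ne'
  have h2 := ((((Real.hasDerivAt_sin θ).pow 2).const_mul (q₁ * (q₃ - q₂))).const_sub
    (q₂ * (q₃ - q₁))).div (hasDerivAt_orbitDen θ) h1
  refine h2.congr_deriv ?_
  congr 1
  simp only [Pi.pow_apply]
  rw [orbitDen]; push_cast; ring

/-- With `dθ/dt = ω Δ` this is `du/dt = 𝓟'(q) / 2`. Differentiating `u² = 𝓟(q)` would require
division by `u`, which vanishes at the turning points; the direct computation covers them too. -/
theorem hasDerivAt_orbitSpeed (θ : ℝ) : HasDerivAt (orbitSpeed q₁ q₂ q₃ q₄)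
    (deriv (quartic a h) (orbitCoord q₁ q₂ q₃ θ) / 2 /
      (frequency q₁ q₂ q₃ q₄ * legendreRadical (modulus q₁ q₂ q₃ q₄) θ)) θ := by
  have hk := H.modulus_sq_lt_one
  have hW := (H.orbitDen_pos θ).ne'
  have hω := H.frequency_pos.ne'
  have hΔ := (legendreRadical_pos hk θ).ne'
  have hd : deriv (quartic a h) (orbitCoord q₁ q₂ q₃ θ) =
      (orbitCoord q₁ q₂ q₃ θ - q₂) * (orbitCoord q₁ q₂ q₃ θ - q₃) * (orbitCoord q₁ q₂ q₃ θ - q₄) +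
      (orbitCoord q₁ q₂ q₃ θ - q₁) * (orbitCoord q₁ q₂ q₃ θ - q₃) * (orbitCoord q₁ q₂ q₃ θ - q₄) +
      (orbitCoord q₁ q₂ q₃ θ - q₁) * (orbitCoord q₁ q₂ q₃ θ - q₂) * (orbitCoord q₁ q₂ q₃ θ - q₄) +
      (orbitCoord q₁ q₂ q₃ θ - q₁) * (orbitCoord q₁ q₂ q₃ θ - q₂) *
        (orbitCoord q₁ q₂ q₃ θ - q₃) := by
    rw [funext H.factor]
    set x := orbitCoord q₁ q₂ q₃ θ
    have := (((((hasDerivAt_id x).sub_const q₁).mul ((hasDerivAt_id x).sub_const q₂)).mul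
      ((hasDerivAt_id x).sub_const q₃)).mul ((hasDerivAt_id x).sub_const q₄)).deriv
    refine this.trans ?_
    simp only [Pi.mul_apply, id]
    ring
  have h1 := (((((Real.hasDerivAt_sin θ).mul (Real.hasDerivAt_cos θ)).mul
    (hasDerivAt_legendreRadical hk θ)).const_mul
      (2 * (q₃ - q₁) * (q₃ - q₂) * (q₂ - q₁) * frequency q₁ q₂ q₃ q₄)).div
        ((hasDerivAt_orbitDen θ).pow 2) (pow_ne_zero 2 hW))
  refine h1.congr_deriv ?_
  rw [hd, H.orbitCoord_sub₁, H.orbitCoord_sub₂, H.orbitCoord_sub₃, H.orbitCoord_sub₄]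
  simp only [Pi.mul_apply, Pi.pow_apply]
  have hΔ2 := legendreRadical_sq hk θ
  have hω2 := H.frequency_sq
  have hk2 : modulus q₁ q₂ q₃ q₄ ^ 2 * ((q₃ - q₁) * (q₄ - q₂)) = (q₃ - q₂) * (q₄ - q₁) := by
    rw [H.modulus_sq]
    exact div_mul_cancel₀ _ (mul_pos (sub_pos.2 H.lt₁₃) (sub_pos.2 H.lt₂₄)).ne'
  have hWd : orbitDen q₁ q₂ q₃ θ = q₃ - q₁ - (q₃ - q₂) * Real.sin θ ^ 2 := rfl
  have hsc := Real.sin_sq_add_cos_sq θ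
  generalize legendreRadical (modulus q₁ q₂ q₃ q₄) θ = Δ at *
  generalize orbitDen q₁ q₂ q₃ θ = W at *
  generalize frequency q₁ q₂ q₃ q₄ = ω at *
  generalize modulus q₁ q₂ q₃ q₄ = k at *
  generalize Real.sin θ = s at *
  generalize Real.cos θ = c at *
  have hc : c ^ 2 = 1 - s ^ 2 := by linear_combination hsc
  have key : (q₄ - q₂) * (((c ^ 2 - s ^ 2) * (1 - k ^ 2 * s ^ 2) - k ^ 2 * c ^ 2 * s ^ 2) * W +
      4 * (q₃ - q₂) * c ^ 2 * s ^ 2 * (1 - k ^ 2 * s ^ 2)) =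
      (q₄ - q₂) * (1 - k ^ 2 * s ^ 2) * (c ^ 2 * ((q₃ - q₂) * s ^ 2 + (q₃ - q₁)) -
        (q₂ - q₁) * s ^ 2) - (q₃ - q₂) * (q₂ - q₁) * c ^ 2 * s ^ 2 := by
    rw [hWd, hc]
    linear_combination (-(s ^ 2 * (1 - s ^ 2))) * hk2
  field_simp
  norm_num
  rw [hΔ2]
  linear_combination ((q₃ - q₁) * (q₃ - q₂) * (q₂ - q₁) * W *
    (((c ^ 2 - s ^ 2) * (1 - k ^ 2 * s ^ 2) - k ^ 2 * c ^ 2 * s ^ 2) * W +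
      4 * (q₃ - q₂) * c ^ 2 * s ^ 2 * (1 - k ^ 2 * s ^ 2))) * hω2 +
    (q₃ - q₁) ^ 2 * (q₃ - q₂) * (q₂ - q₁) * W * key

end IsRootSystem

end Orbit

/-! ### The oval over `[q₂, q₃]` and its identification with the component -/

section Oval

variable {a h q₁ q₂ q₃ q₄ : ℝ}

/-- The part of the level set over the interval between the two middle roots. -/
def oval (a h q₂ q₃ : ℝ) : Set (ℝ × ℝ) := {z | z ∈ levelSet a h ∧ z.1 ∈ Icc q₂ q₃}

/-- The parametrization of the closed curve by the amplitude. -/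
noncomputable def orbitPhase (a q₁ q₂ q₃ q₄ θ : ℝ) : ℝ × ℝ :=
  phasePoint a (orbitCoord q₁ q₂ q₃ θ) (orbitSpeed q₁ q₂ q₃ q₄ θ)

theorem orbitPhase_add_pi (θ : ℝ) :
    orbitPhase a q₁ q₂ q₃ q₄ (θ + Real.pi) = orbitPhase a q₁ q₂ q₃ q₄ θ := by
  simp [orbitPhase, orbitCoord, orbitSpeed, orbitDen, legendreRadical, Real.sin_add_pi,
    Real.cos_add_pi]

theorem swap_mem_levelSet {z : ℝ × ℝ} (hz : z ∈ levelSet a h) : z.swap ∈ levelSet a h := by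
  have : invariant a z = h := hz
  change invariant a z.swap = h
  rw [← this]
  simp only [invariant, Prod.fst_swap, Prod.snd_swap]; ring

namespace IsRootSystem

variable (H : IsRootSystem a h q₁ q₂ q₃ q₄)
include H

theorem continuous_orbitPhase : Continuous (orbitPhase a q₁ q₂ q₃ q₄) := by
  have h1 : Continuous (orbitCoord q₁ q₂ q₃) :=
    continuous_iff_continuousAt.2 fun θ => (H.hasDerivAt_orbitCoord θ).continuousAt
  have h2 : Continuous (orbitSpeed q₁ q₂ q₃ q₄) :=
    continuous_iff_continuousAt.2 fun θ => (H.hasDerivAt_orbitSpeed θ).continuousAt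
  unfold orbitPhase phasePoint
  refine h1.prodMk (Continuous.div (by fun_prop) (by fun_prop) fun θ h0 => ?_)
  exact H.orbitCoord_ne θ (by linarith)

theorem orbitPhase_mem (θ : ℝ) : orbitPhase a q₁ q₂ q₃ q₄ θ ∈ oval a h q₂ q₃ := by
  refine ⟨mem_levelSet_of_momentumPartial_sq (H.orbitCoord_ne θ) ?_, H.orbitCoord_mem θ⟩
  rw [orbitPhase, momentumPartial_phasePoint (H.orbitCoord_ne θ), H.orbitSpeed_sq]
  rfl

theorem orbitCoord_eq_of_sin_sq {θ x : ℝ} (hx : q₁ < x)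
    (hs : Real.sin θ ^ 2 = (q₃ - q₁) / (q₃ - q₂) * ((x - q₂) / (x - q₁))) :
    orbitCoord q₁ q₂ q₃ θ = x := by
  have h1 := (H.orbitDen_pos θ).ne'
  have h2 := (sub_pos.2 H.lt₂₃).ne'
  have h3 := (sub_pos.2 hx).ne'
  rw [orbitCoord, div_eq_iff h1, orbitDen, hs]
  field_simp
  ring

theorem sin_sq_mem {x : ℝ} (hx : x ∈ Icc q₂ q₃) :
    0 ≤ (q₃ - q₁) / (q₃ - q₂) * ((x - q₂) / (x - q₁)) ∧
      (q₃ - q₁) / (q₃ - q₂) * ((x - q₂) / (x - q₁)) ≤ 1 := by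
  have h2 := sub_pos.2 H.lt₂₃
  have h3 := sub_pos.2 (H.lt₁₂.trans_le hx.1)
  have h4 := sub_pos.2 H.lt₁₃
  have h5 := sub_nonneg.2 hx.1
  refine ⟨by positivity, ?_⟩
  rw [div_mul_div_comm, div_le_one (by positivity)]
  nlinarith [mul_nonneg (sub_pos.2 H.lt₁₂).le (sub_nonneg.2 hx.2)]

theorem range_orbitPhase : range (orbitPhase a q₁ q₂ q₃ q₄) = oval a h q₂ q₃ := by
  refine Subset.antisymm (range_subset_iff.2 H.orbitPhase_mem) fun z hz => ?_
  obtain ⟨hR0, hR1⟩ := H.sin_sq_mem hz.2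
  set R := (q₃ - q₁) / (q₃ - q₂) * ((z.1 - q₂) / (z.1 - q₁))
  have hsin : Real.sin (Real.arcsin √R) ^ 2 = R := by
    rw [Real.sin_arcsin (by linarith [Real.sqrt_nonneg R]) (Real.sqrt_le_one.2 hR1),
      Real.sq_sqrt hR0]
  set θ := Real.arcsin √R
  have hθ : orbitCoord q₁ q₂ q₃ θ = z.1 :=
    H.orbitCoord_eq_of_sin_sq (H.lt₁₂.trans_le hz.2.1) hsin
  have hsq : momentumPartial a z ^ 2 = orbitSpeed q₁ q₂ q₃ q₄ θ ^ 2 := by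
    rw [momentumPartial_sq_of_mem hz.1, H.orbitSpeed_sq, hθ]
  have hz1 : z.1 ≠ -1 := (H.neg_one_lt.trans_le hz.2.1).ne'
  -- Replacing `θ` by `-θ` keeps the coordinate and reverses the velocity, which reaches the other
  -- branch.
  rcases sq_eq_sq_iff_eq_or_eq_neg.1 hsq with h1 | h1
  · refine ⟨θ, ?_⟩
    rw [orbitPhase, hθ, ← h1, phasePoint_momentumPartial hz1]
  · refine ⟨-θ, ?_⟩
    have e1 : orbitCoord q₁ q₂ q₃ (-θ) = orbitCoord q₁ q₂ q₃ θ := by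
      simp [orbitCoord, orbitDen]
    have e2 : orbitSpeed q₁ q₂ q₃ q₄ (-θ) = -orbitSpeed q₁ q₂ q₃ q₄ θ := by
      simp [orbitSpeed, orbitDen, legendreRadical, neg_div]
    rw [orbitPhase, e1, e2, hθ, ← h1, phasePoint_momentumPartial hz1]

theorem sin_sq_eq_of_orbitCoord_eq {x y : ℝ}
    (hxy : orbitCoord q₁ q₂ q₃ x = orbitCoord q₁ q₂ q₃ y) :
    Real.sin x ^ 2 = Real.sin y ^ 2 := by
  have h1 := H.orbitCoord_sub₁ x
  rw [hxy, H.orbitCoord_sub₁ y] at h1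
  have h2 := (H.orbitDen_pos x).ne'
  have h3 := (H.orbitDen_pos y).ne'
  have h4 := (mul_pos (sub_pos.2 H.lt₁₃) (sub_pos.2 H.lt₁₂)).ne'
  rw [div_eq_div_iff h3 h2] at h1
  have h5 := mul_left_cancel₀ h4 h1
  simp only [orbitDen] at h5
  exact mul_left_cancel₀ (sub_pos.2 H.lt₂₃).ne' (by linarith)

/-- The coordinate determines `sin θ ≥ 0`; if this is nonzero, the velocity determines `cos θ`, and
otherwise `θ = 0`. -/
theorem injOn_orbitPhase : InjOn (orbitPhase a q₁ q₂ q₃ q₄) (Ico 0 Real.pi) := by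
  intro x hx y hy hxy
  have hq : orbitCoord q₁ q₂ q₃ x = orbitCoord q₁ q₂ q₃ y := congrArg Prod.fst hxy
  have hu : orbitSpeed q₁ q₂ q₃ q₄ x = orbitSpeed q₁ q₂ q₃ q₄ y := by
    have := congrArg (momentumPartial a) hxy
    rwa [orbitPhase, orbitPhase, momentumPartial_phasePoint (H.orbitCoord_ne x),
      momentumPartial_phasePoint (H.orbitCoord_ne y)] at this
  have hs2 := H.sin_sq_eq_of_orbitCoord_eq hq
  have hsx := Real.sin_nonneg_of_nonneg_of_le_pi hx.1 hx.2.le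
  have hsy := Real.sin_nonneg_of_nonneg_of_le_pi hy.1 hy.2.le
  have hs : Real.sin x = Real.sin y := (sq_eq_sq₀ hsx hsy).1 hs2
  have hW := H.orbitDen_pos y
  have hΔ := legendreRadical_pos H.modulus_sq_lt_one y
  have hω := H.frequency_pos
  have hA := sub_pos.2 H.lt₁₃
  have hB := sub_pos.2 H.lt₂₃
  have hδ := sub_pos.2 H.lt₁₂
  have hWW : orbitDen q₁ q₂ q₃ x = orbitDen q₁ q₂ q₃ y := by simp only [orbitDen, hs]
  have hΔΔ : legendreRadical (modulus q₁ q₂ q₃ q₄) x = legendreRadical (modulus q₁ q₂ q₃ q₄) y := by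
    simp only [legendreRadical, hs]
  simp only [orbitSpeed, hWW, hΔΔ, hs] at hu
  rcases eq_or_lt_of_le hsy with h0 | h0
  · have key : ∀ t ∈ Ico 0 Real.pi, Real.sin t = 0 → t = 0 := fun t ht h1 => by
      by_contra h2
      exact (Real.sin_pos_of_pos_of_lt_pi (lt_of_le_of_ne ht.1 (Ne.symm h2)) ht.2).ne' h1
    rw [key x hx (hs.trans h0.symm), key y hy h0.symm]
  · refine Real.injOn_cos ⟨hx.1, hx.2.le⟩ ⟨hy.1, hy.2.le⟩ ?_
    field_simp at hu
    exact hu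

theorem isPreconnected_oval : IsPreconnected (oval a h q₂ q₃) := by
  rw [← H.range_orbitPhase]
  exact isPreconnected_range H.continuous_orbitPhase

theorem isCompact_oval : IsCompact (oval a h q₂ q₃) := by
  have : oval a h q₂ q₃ = orbitPhase a q₁ q₂ q₃ q₄ '' Icc 0 Real.pi := by
    rw [← H.range_orbitPhase]
    have hper : Function.Periodic (orbitPhase a q₁ q₂ q₃ q₄) Real.pi := orbitPhase_add_pi
    simpa using (hper.image_Icc Real.pi_pos 0).symm
  rw [this]
  exact isCompact_Icc.image H.continuous_orbitPhase

theorem fst_image_oval : Prod.fst '' oval a h q₂ q₃ = Icc q₂ q₃ := by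
  refine Subset.antisymm (image_subset_iff.2 fun z hz => hz.2) fun x hx => ?_
  have hP : 0 ≤ quartic a h x := by
    rw [H.factor]
    have h1 := sub_pos.2 (H.lt₁₂.trans_le hx.1)
    have h2 := sub_nonneg.2 hx.1
    have h3 := sub_nonneg.2 hx.2
    have h4 := sub_pos.2 (hx.2.trans_lt H.lt₃₄)
    have := mul_nonneg (mul_nonneg (mul_nonneg h1.le h2) h3) h4.le
    linarith
  have hx1 : x ≠ -1 := (H.neg_one_lt.trans_le hx.1).ne'
  refine ⟨phasePoint a x √(quartic a h x), ⟨mem_levelSet_of_momentumPartial_sq hx1 ?_, hx⟩, rfl⟩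
  rw [momentumPartial_phasePoint hx1, Real.sq_sqrt hP]
  rfl

/-- The projection of `K` is an interval on which the quartic is nonnegative, so it cannot cross the
gaps `(q₁, q₂)` and `(q₃, q₄)`. -/
theorem subset_oval {K : Set (ℝ × ℝ)} (hK : IsPreconnected K) (hKl : K ⊆ levelSet a h)
    {w : ℝ × ℝ} (hw : w ∈ K) (hwo : w.1 ∈ Icc q₂ q₃) : K ⊆ oval a h q₂ q₃ := by
  intro z hz
  have hord := (hK.image Prod.fst continuous_fst.continuousOn).ordConnected
  have hnn : ∀ x ∈ Prod.fst '' K, 0 ≤ quartic a h x := by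
    rintro _ ⟨y, hy, rfl⟩
    exact quartic_nonneg_of_mem (hKl hy)
  refine ⟨hKl hz, ?_, ?_⟩
  · by_contra! h0
    have hm : max z.1 q₁ < q₂ := max_lt h0 H.lt₁₂
    have hx := hnn _ (hord.out ⟨z, hz, rfl⟩ ⟨w, hw, rfl⟩
      (show (max z.1 q₁ + q₂) / 2 ∈ Icc z.1 w.1 from
        ⟨by linarith [le_max_left z.1 q₁], by linarith [hwo.1]⟩))
    rw [H.factor] at hx
    have h1 : 0 < (max z.1 q₁ + q₂) / 2 - q₁ := by linarith [le_max_right z.1 q₁]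
    have h2 : 0 < q₂ - (max z.1 q₁ + q₂) / 2 := by linarith
    have h3 : 0 < q₃ - (max z.1 q₁ + q₂) / 2 := by linarith [H.lt₂₃]
    have h4 : 0 < q₄ - (max z.1 q₁ + q₂) / 2 := by linarith [H.lt₂₄]
    linarith [mul_pos (mul_pos (mul_pos h1 h2) h3) h4]
  · by_contra! h0
    have hm : q₃ < min z.1 q₄ := lt_min h0 H.lt₃₄
    have hx := hnn _ (hord.out ⟨w, hw, rfl⟩ ⟨z, hz, rfl⟩
      (show (min z.1 q₄ + q₃) / 2 ∈ Icc w.1 z.1 from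
        ⟨by linarith [hwo.2], by linarith [min_le_left z.1 q₄]⟩))
    rw [H.factor] at hx
    have h1 : 0 < (min z.1 q₄ + q₃) / 2 - q₁ := by linarith [H.lt₁₃]
    have h2 : 0 < (min z.1 q₄ + q₃) / 2 - q₂ := by linarith [H.lt₂₃]
    have h3 : 0 < (min z.1 q₄ + q₃) / 2 - q₃ := by linarith
    have h4 : 0 < q₄ - (min z.1 q₄ + q₃) / 2 := by linarith [min_le_right z.1 q₄]
    linarith [mul_pos (mul_pos (mul_pos h1 h2) h3) h4]

theorem component_eq_oval {z w : ℝ × ℝ} (hw : w ∈ connectedComponentIn (levelSet a h) z)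
    (hwo : w.1 ∈ Icc q₂ q₃) : connectedComponentIn (levelSet a h) z = oval a h q₂ q₃ := by
  refine Subset.antisymm (H.subset_oval isPreconnected_connectedComponentIn
    (connectedComponentIn_subset _ _) hw hwo) ?_
  rw [connectedComponentIn_eq hw]
  exact H.isPreconnected_oval.subset_connectedComponentIn
    ⟨connectedComponentIn_subset _ _ hw, hwo⟩ fun z hz => hz.1

theorem swap_mem_oval {w : ℝ × ℝ} (hw : w ∈ oval a h q₂ q₃) (hw' : w.swap ∈ oval a h q₂ q₃)
    {z : ℝ × ℝ} (hz : z ∈ oval a h q₂ q₃) : z.swap ∈ oval a h q₂ q₃ :=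
  H.subset_oval (K := Prod.swap '' oval a h q₂ q₃)
    (H.isPreconnected_oval.image _ continuous_swap.continuousOn)
    (by rintro _ ⟨y, hy, rfl⟩; exact swap_mem_levelSet hy.1) ⟨w, hw, rfl⟩ hw'.2 ⟨z, hz, rfl⟩

end IsRootSystem

end Oval

theorem exists_root_system_of_isClosedLevelCurve {a h : ℝ} (ha : |a| < 2) (hh : 0 < h)
    {C : Set (ℝ × ℝ)} (hC : IsClosedLevelCurve a h C) :
    ∃ q₁ q₂ q₃ q₄, IsRootSystem a h q₁ q₂ q₃ q₄ ∧ C = oval a h q₂ q₃ ∧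
      ∀ z ∈ C, z.swap ∈ C := by
  obtain ⟨hcomp, z, hz, rfl⟩ := hC
  change IsCompact (connectedComponentIn (levelSet a h) z) at hcomp
  obtain ⟨h₁, h₂, e, he, hw⟩ := exists_antidiagonal_mem_of_isCompact ha hh hz hcomp
  obtain ⟨q₁, q₂, q₃, q₄, H, hr₂, hr₃⟩ := exists_isRootSystem ha hh h₁ h₂
  have hr0 : 0 ≤ √(h / (2 + a)) := Real.sqrt_nonneg _
  have hmem : ∀ e : ℝ, (e = 1 ∨ e = -1) →
      (-(e * √(h / (2 + a))), e * √(h / (2 + a))) ∈ oval a h q₂ q₃ := fun e he => by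
    refine ⟨antidiagonal_mem ha hh he, ?_⟩
    rcases he with rfl | rfl <;> constructor <;> simp only <;> linarith
  have hCo := H.component_eq_oval hw (hmem e he).2
  refine ⟨q₁, q₂, q₃, q₄, H, hCo, fun y hy => ?_⟩
  change y ∈ connectedComponentIn (levelSet a h) z at hy
  change y.swap ∈ connectedComponentIn (levelSet a h) z
  rw [hCo] at hy ⊢
  refine H.swap_mem_oval (hmem 1 (Or.inl rfl)) ?_ hy
  convert hmem (-1) (Or.inr rfl) using 1
  ext <;> simp

/-! ### Hamilton's equations and uniqueness of trajectories -/

/-- The Hamiltonian vector field of the invariant. -/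
def hamiltonianField (a : ℝ) (z : ℝ × ℝ) : ℝ × ℝ := (momentumPartial a z, -coordinatePartial a z)

theorem hasDerivAt_invariant_momentum (a q p : ℝ) :
    HasDerivAt (fun p => invariant a (q, p)) (momentumPartial a (q, p)) p := by
  have h2 := hasDerivAt_pow 2 p
  have h1 := hasDerivAt_id p
  have := ((((h2.mul_const q).add (h1.mul_const (q ^ 2))).add h2).sub
    ((h1.const_mul a).mul_const q)).add_const (q ^ 2)
  refine this.congr_deriv ?_
  simp only [momentumPartial]; push_cast; ring

theorem hasDerivAt_invariant_coordinate (a q p : ℝ) :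
    HasDerivAt (fun q => invariant a (q, p)) (coordinatePartial a (q, p)) q := by
  have h2 := hasDerivAt_pow 2 q
  have h1 := hasDerivAt_id q
  have := ((((h1.const_mul (p ^ 2)).add (h2.const_mul p)).add_const (p ^ 2)).sub
    (h1.const_mul (a * p))).add h2
  refine this.congr_deriv ?_
  simp only [coordinatePartial]; push_cast; ring

theorem isHamiltonianTrajectory_iff {a : ℝ} {γ : ℝ → ℝ × ℝ} :
    IsHamiltonianTrajectory a γ ↔ ∀ t, HasDerivAt γ (hamiltonianField a (γ t)) t := by
  refine forall_congr' fun t => ?_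
  rw [(hasDerivAt_invariant_momentum a (γ t).1 (γ t).2).deriv,
    (hasDerivAt_invariant_coordinate a (γ t).1 (γ t).2).deriv]
  constructor
  · rintro ⟨h1, h2⟩
    exact h1.prodMk h2
  · intro h1
    exact ⟨(hasFDerivAt_fst.comp_hasDerivAt t h1 :), (hasFDerivAt_snd.comp_hasDerivAt t h1 :)⟩

theorem continuous_hamiltonianField (a : ℝ) : Continuous (hamiltonianField a) := by
  unfold hamiltonianField momentumPartial coordinatePartial; fun_prop

theorem contDiff_hamiltonianField (a : ℝ) : ContDiff ℝ 1 (hamiltonianField a) := by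
  unfold hamiltonianField momentumPartial coordinatePartial; fun_prop

theorem hamiltonian_trajectory_unique {a : ℝ} {K : Set (ℝ × ℝ)} (hK : IsCompact K)
    {γ δ : ℝ → ℝ × ℝ} (hγ : ∀ t, HasDerivAt γ (hamiltonianField a (γ t)) t)
    (hδ : ∀ t, HasDerivAt δ (hamiltonianField a (δ t)) t) (hγK : ∀ t, γ t ∈ K)
    (hδK : ∀ t, δ t ∈ K) (h0 : γ 0 = δ 0) : γ = δ := by
  obtain ⟨L, hL⟩ := LocallyLipschitzOn.exists_lipschitzOnWith_of_compact hK
    (contDiff_hamiltonianField a).locallyLipschitz.locallyLipschitzOn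
  exact ODE_solution_unique_univ (v := fun _ => hamiltonianField a) (s := fun _ => K)
    (fun _ => hL) (fun t => ⟨hγ t, hγK t⟩) (fun t => ⟨hδ t, hδK t⟩) h0

/-! ### Invariance of the flow under the map -/

section Map

variable {a : ℝ}

theorem invariant_sextupoleMap {z : ℝ × ℝ} (hz : z.2 ≠ -1) :
    invariant a (sextupoleMap a z) = invariant a z := by
  have : z.2 + 1 ≠ 0 := fun h0 => hz (by linarith)
  simp only [invariant, sextupoleMap, force]
  field_simp
  ring

theorem momentumPartial_sextupoleMap {z : ℝ × ℝ} (hz : z.2 ≠ -1) :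
    momentumPartial a (sextupoleMap a z) = -coordinatePartial a z := by
  have : z.2 + 1 ≠ 0 := fun h0 => hz (by linarith)
  simp only [momentumPartial, coordinatePartial, sextupoleMap, force]
  field_simp
  ring

/-- The map carries Hamiltonian trajectories to Hamiltonian trajectories. -/
theorem hasDerivAt_sextupoleMap_comp {γ : ℝ → ℝ × ℝ} {t : ℝ}
    (hγ : HasDerivAt γ (hamiltonianField a (γ t)) t) (hp : (γ t).2 ≠ -1) :
    HasDerivAt (fun s => sextupoleMap a (γ s)) (hamiltonianField a (sextupoleMap a (γ t))) t := by
  have hne : (γ t).2 + 1 ≠ 0 := fun h0 => hp (by linarith)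
  have h1 : HasDerivAt (fun s => (γ s).1) (momentumPartial a (γ t)) t :=
    (hasFDerivAt_fst.comp_hasDerivAt t hγ :)
  have h2 : HasDerivAt (fun s => (γ s).2) (-coordinatePartial a (γ t)) t :=
    (hasFDerivAt_snd.comp_hasDerivAt t hγ :)
  have h3 : HasDerivAt (fun s => -(γ s).1 + force a (γ s).2) _ t :=
    h1.neg.add (h2.neg.mul ((h2.sub_const a).div (h2.add_const 1) hne))
  refine HasDerivAt.congr_deriv (h2.prodMk h3) ?_
  simp only [hamiltonianField, momentumPartial_sextupoleMap hp]
  ext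
  · rfl
  · simp only [coordinatePartial, momentumPartial, sextupoleMap, force, Pi.neg_apply]
    field_simp
    ring

end Map

/-! ### The explicit periodic solution -/

section Orbit

variable {a h q₁ q₂ q₃ q₄ : ℝ}

theorem hasDerivAt_quartic (a h x : ℝ) : HasDerivAt (quartic a h)
    (4 * x ^ 3 - 6 * (2 + a) * x ^ 2 + 2 * (a ^ 2 - 4) * x + 4 * h) x := by
  have := ((((hasDerivAt_pow 4 x).sub ((hasDerivAt_pow 3 x).const_mul (2 * (2 + a)))).add
    ((hasDerivAt_pow 2 x).const_mul (a ^ 2 - 4))).add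
      ((hasDerivAt_id x).const_mul (4 * h))).add_const (4 * h)
  refine this.congr_deriv ?_
  push_cast; ring

theorem hasDerivAt_phasePoint {q u : ℝ → ℝ} {t : ℝ} (hq : HasDerivAt q (u t) t)
    (hu : HasDerivAt u (deriv (quartic a h) (q t) / 2) t) (hne : q t ≠ -1)
    (hsq : u t ^ 2 = quartic a h (q t)) :
    HasDerivAt (fun s => phasePoint a (q s) (u s))
      (hamiltonianField a (phasePoint a (q t) (u t))) t := by
  have hne' : q t + 1 ≠ 0 := fun h0 => hne (by linarith)
  rw [(hasDerivAt_quartic a h (q t)).deriv] at hu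
  have h2 : HasDerivAt (fun s => (u s - q s ^ 2 + a * q s) / (2 * (q s + 1))) _ t :=
    ((hu.sub (hq.pow 2)).add (hq.const_mul a)).div ((hq.add_const 1).const_mul 2) (by positivity)
  refine HasDerivAt.congr_deriv (hq.prodMk h2) ?_
  rw [hamiltonianField, momentumPartial_phasePoint hne]
  ext
  · rfl
  · simp only [coordinatePartial, phasePoint, Pi.add_apply, Pi.sub_apply, Pi.pow_apply]
    simp only [quartic] at hsq
    push_cast
    field_simp
    generalize q t = x at *
    generalize u t = y at *
    linear_combination (-1) * hsq

/-- The periodic solution of Hamilton's equations on the closed curve. -/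
noncomputable def orbit (a q₁ q₂ q₃ q₄ t : ℝ) : ℝ × ℝ :=
  orbitPhase a q₁ q₂ q₃ q₄ (amplitude (modulus q₁ q₂ q₃ q₄) (frequency q₁ q₂ q₃ q₄ * t))

namespace IsRootSystem

variable (H : IsRootSystem a h q₁ q₂ q₃ q₄)
include H

theorem hasDerivAt_orbit (t : ℝ) : HasDerivAt (orbit a q₁ q₂ q₃ q₄)
    (hamiltonianField a (orbit a q₁ q₂ q₃ q₄ t)) t := by
  have hk := H.modulus_sq_lt_one
  have hθ : HasDerivAt (fun s => amplitude (modulus q₁ q₂ q₃ q₄) (frequency q₁ q₂ q₃ q₄ * s)) _ t :=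
    (hasDerivAt_amplitude hk _).comp t ((hasDerivAt_id t).const_mul (frequency q₁ q₂ q₃ q₄))
  set θ := fun s => amplitude (modulus q₁ q₂ q₃ q₄) (frequency q₁ q₂ q₃ q₄ * s) with hθdef
  have hω := H.frequency_pos.ne'
  have hΔ := (legendreRadical_pos hk (θ t)).ne'
  have hq : HasDerivAt (fun s => orbitCoord q₁ q₂ q₃ (θ s)) (orbitSpeed q₁ q₂ q₃ q₄ (θ t)) t := by
    refine ((H.hasDerivAt_orbitCoord (θ t)).comp t hθ).congr_deriv ?_
    rw [orbitSpeed]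
    simp only [hθdef, mul_one]
    ring
  have hu : HasDerivAt (fun s => orbitSpeed q₁ q₂ q₃ q₄ (θ s))
      (deriv (quartic a h) (orbitCoord q₁ q₂ q₃ (θ t)) / 2) t := by
    refine ((H.hasDerivAt_orbitSpeed (θ t)).comp t hθ).congr_deriv ?_
    simp only [hθdef, mul_one] at hΔ ⊢
    field_simp
  exact hasDerivAt_phasePoint (h := h) hq hu (H.orbitCoord_ne _) (H.orbitSpeed_sq _)

theorem range_orbit : range (orbit a q₁ q₂ q₃ q₄) = oval a h q₂ q₃ := by
  rw [← H.range_orbitPhase]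
  have hω := H.frequency_pos.ne'
  refine Function.Surjective.range_comp (f := fun t =>
    amplitude (modulus q₁ q₂ q₃ q₄) (frequency q₁ q₂ q₃ q₄ * t)) (fun θ => ?_) _
  refine ⟨ellipticF θ (modulus q₁ q₂ q₃ q₄) / frequency q₁ q₂ q₃ q₄, ?_⟩
  simp only
  rw [mul_div_cancel₀ _ hω, amplitude_ellipticF H.modulus_sq_lt_one]

theorem periodic_orbit : Function.Periodic (orbit a q₁ q₂ q₃ q₄)
    (2 * ellipticK (modulus q₁ q₂ q₃ q₄) / frequency q₁ q₂ q₃ q₄) := fun t => by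
  rw [orbit, mul_add, mul_div_cancel₀ _ H.frequency_pos.ne', amplitude_add H.modulus_sq_lt_one,
    orbitPhase_add_pi]
  rfl

theorem period_pos : 0 < 2 * ellipticK (modulus q₁ q₂ q₃ q₄) / frequency q₁ q₂ q₃ q₄ :=
  div_pos (mul_pos two_pos (ellipticK_pos H.modulus_sq_lt_one)) H.frequency_pos

theorem injOn_orbit : InjOn (orbit a q₁ q₂ q₃ q₄)
    (Ico 0 (2 * ellipticK (modulus q₁ q₂ q₃ q₄) / frequency q₁ q₂ q₃ q₄)) := by
  have hk := H.modulus_sq_lt_one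
  have hω := H.frequency_pos
  have hmaps : ∀ t ∈ Ico 0 (2 * ellipticK (modulus q₁ q₂ q₃ q₄) / frequency q₁ q₂ q₃ q₄),
      amplitude (modulus q₁ q₂ q₃ q₄) (frequency q₁ q₂ q₃ q₄ * t) ∈ Ico 0 Real.pi := fun t ht => by
    have hpi := amplitude_add hk 0
    rw [zero_add, amplitude_zero hk, zero_add] at hpi
    constructor
    · rw [← amplitude_zero hk]
      exact (amplitude_strictMono hk).monotone (mul_nonneg hω.le ht.1)
    · rw [← hpi]
      refine amplitude_strictMono hk ?_
      have := (lt_div_iff₀ hω).1 ht.2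
      linarith
  intro s hs t ht hst
  have := (amplitude_strictMono hk).injective (H.injOn_orbitPhase (hmaps s hs) (hmaps t ht) hst)
  exact mul_left_cancel₀ hω.ne' this

theorem isLeast_period : IsLeast {t : ℝ | 0 < t ∧ Function.Periodic (orbit a q₁ q₂ q₃ q₄) t}
    (2 * ellipticK (modulus q₁ q₂ q₃ q₄) / frequency q₁ q₂ q₃ q₄) := by
  refine ⟨⟨H.period_pos, H.periodic_orbit⟩, fun t ht => ?_⟩
  by_contra! h0
  have h1 := ht.2 0
  rw [zero_add] at h1
  exact ht.1.ne' (H.injOn_orbit ⟨ht.1.le, h0⟩ ⟨le_rfl, H.period_pos⟩ h1)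

/-- Differentiating `momentumPartial_sq` in `q` where `∂H/∂p = 0` gives `𝓟'(q₂) = -4 (q₂ + 1)
∂H/∂q`, and `𝓟'(q₂) > 0`. The sign later selects the branch of the arcsine. -/
theorem coordinatePartial_left_neg : coordinatePartial a (phasePoint a q₂ 0) < 0 := by
  have hne : q₂ ≠ -1 := H.neg_one_lt.ne'
  have hpos : 0 < q₂ + 1 := by linarith [H.neg_one_lt]
  have h1 := (hasDerivAt_quartic a h q₂).deriv
  have h2 : deriv (quartic a h) q₂ = (q₂ - q₁) * (q₂ - q₃) * (q₂ - q₄) := by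
    rw [funext H.factor]
    have := (((((hasDerivAt_id q₂).sub_const q₁).mul ((hasDerivAt_id q₂).sub_const q₂)).mul
      ((hasDerivAt_id q₂).sub_const q₃)).mul ((hasDerivAt_id q₂).sub_const q₄)).deriv
    refine this.trans ?_
    simp only [Pi.mul_apply, id]
    ring
  have h3 : 0 < (q₂ - q₁) * (q₂ - q₃) * (q₂ - q₄) := by
    nlinarith [mul_pos (mul_pos (sub_pos.2 H.lt₁₂) (sub_pos.2 H.lt₂₃)) (sub_pos.2 H.lt₂₄)]
  have hP : quartic a h q₂ = 0 := by rw [H.factor]; ring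
  have h4 : (q₂ - q₁) * (q₂ - q₃) * (q₂ - q₄) =
      -4 * (q₂ + 1) * coordinatePartial a (phasePoint a q₂ 0) := by
    rw [← h2, h1]
    simp only [quartic] at hP
    simp only [coordinatePartial, phasePoint]
    field_simp
    linear_combination (4 : ℝ) * hP
  by_contra! h5
  nlinarith [mul_nonneg hpos.le h5]

end IsRootSystem

end Orbit

variable {a h q₁ q₂ q₃ q₄ : ℝ}

theorem contDiff_one_of_hamiltonian {γ : ℝ → ℝ × ℝ}
    (hγ : ∀ t, HasDerivAt γ (hamiltonianField a (γ t)) t) : ContDiff ℝ 1 γ := by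
  rw [contDiff_one_iff_deriv]
  have hd : Differentiable ℝ γ := fun t => (hγ t).differentiableAt
  refine ⟨hd, ?_⟩
  rw [funext fun t => (hγ t).deriv]
  exact (continuous_hamiltonianField a).comp hd.continuous

/-! ### Orientation, rotation number and the time shift -/

namespace IsRootSystem

variable (H : IsRootSystem a h q₁ q₂ q₃ q₄)
include H

theorem orbit_mem (t : ℝ) : orbit a q₁ q₂ q₃ q₄ t ∈ oval a h q₂ q₃ := H.orbitPhase_mem _

theorem orbit_zero : orbit a q₁ q₂ q₃ q₄ 0 = phasePoint a q₂ 0 := by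
  have h1 : orbitCoord q₁ q₂ q₃ 0 = q₂ := by
    have := (sub_pos.2 H.lt₁₃).ne'
    simp [orbitCoord, orbitDen, this]
  rw [orbit, mul_zero, amplitude_zero H.modulus_sq_lt_one, orbitPhase, h1]
  simp [orbitSpeed]

/-- The orbit encloses a positive area, hence is traversed clockwise. -/
theorem integral_momentum_pos {T : ℝ} (hT : 0 < T)
    (hper : Function.Periodic (orbit a q₁ q₂ q₃ q₄) T) :
    0 < ∫ s in (0 : ℝ)..1, (orbit a q₁ q₂ q₃ q₄ (T * s)).2 *
      (deriv (fun s => orbit a q₁ q₂ q₃ q₄ (T * s)) s).1 := by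
  set c : ℝ → ℝ × ℝ := fun s => orbit a q₁ q₂ q₃ q₄ (T * s) with hc
  have hcd : ∀ s, HasDerivAt c (T • hamiltonianField a (c s)) s := fun s => by
    have := HasDerivAt.scomp s (H.hasDerivAt_orbit (T * s)) ((hasDerivAt_id s).const_mul T)
    simpa [Function.comp_def] using this
  have hcc : Continuous c := continuous_iff_continuousAt.2 fun s => (hcd s).continuousAt
  have hq : ∀ s, HasDerivAt (fun s => (c s).1) (T * momentumPartial a (c s)) s := fun s =>
    (hasFDerivAt_fst.comp_hasDerivAt s (hcd s) :)
  have hlt : ∀ s, -1 < (c s).1 := fun s => H.neg_one_lt.trans_le (H.orbit_mem _).2.1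
  have hu : Continuous fun s => momentumPartial a (c s) := by
    unfold momentumPartial; fun_prop
  -- Solving `u = ∂H/∂p` for `p` splits `p dq` into a nonnegative term `u² / (2 (q + 1))` and a form
  -- in `q` alone, which integrates to zero over a period.
  have hsplit : ∀ s, (c s).2 * (deriv c s).1 =
      T * (momentumPartial a (c s) ^ 2 / (2 * ((c s).1 + 1))) +
        ((fun x => (a * x - x ^ 2) / (2 * (x + 1))) ∘ fun s => (c s).1) s *
          (T * momentumPartial a (c s)) := fun s => by
    have : (c s).1 + 1 ≠ 0 := by linarith [hlt s]
    rw [(hcd s).deriv]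
    simp only [hamiltonianField, momentumPartial, Prod.smul_fst, smul_eq_mul, Function.comp]
    field_simp
    ring
  have hexact : ∫ s in (0 : ℝ)..1,
      ((fun x => (a * x - x ^ 2) / (2 * (x + 1))) ∘ fun s => (c s).1) s *
          (T * momentumPartial a (c s)) = 0 := by
    rw [intervalIntegral.integral_comp_mul_deriv' (fun s _ => hq s)
      (continuous_const.mul hu).continuousOn]
    · have : c 1 = c 0 := by simpa [hc] using hper 0
      simp only [this, intervalIntegral.integral_same]
    · rintro _ ⟨s, -, rfl⟩
      refine ContinuousAt.continuousWithinAt (ContinuousAt.div (by fun_prop) (by fun_prop) ?_)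
      simp only
      linarith [hlt s]
  have hc1 : Continuous fun s => T * (momentumPartial a (c s) ^ 2 / (2 * ((c s).1 + 1))) := by
    refine continuous_const.mul ((hu.pow 2).div (by fun_prop) fun s => ?_)
    linarith [hlt s]
  have hc2 : Continuous fun s =>
      ((fun x => (a * x - x ^ 2) / (2 * (x + 1))) ∘ fun s => (c s).1) s *
          (T * momentumPartial a (c s)) := by
    refine Continuous.mul (Continuous.div (by fun_prop) (by fun_prop) fun s => ?_) (by fun_prop)
    simp only
    linarith [hlt s]
  change 0 < ∫ s in (0 : ℝ)..1, (c s).2 * (deriv c s).1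
  simp only [hsplit]
  rw [intervalIntegral.integral_add (hc1.intervalIntegrable _ _) (hc2.intervalIntegrable _ _),
    hexact, add_zero]
  refine intervalIntegral.integral_pos one_pos hc1.continuousOn (fun s _ => ?_) ?_
  · have : 0 < (c s).1 + 1 := by linarith [hlt s]
    positivity
  -- Strict positivity is checked where `q` is the midpoint of `[q₂, q₃]`, since the quartic is
  -- positive there.
  · obtain ⟨z, hz, hzm⟩ : (q₂ + q₃) / 2 ∈ Prod.fst '' oval a h q₂ q₃ := by
      rw [H.fst_image_oval]
      constructor <;> linarith [H.lt₂₃]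
    rw [← H.range_orbit] at hz
    obtain ⟨t, rfl⟩ := hz
    obtain ⟨t', ht', htt'⟩ := hper.exists_mem_Ico₀ hT t
    refine ⟨t' / T, ⟨div_nonneg ht'.1 hT.le, (div_le_one hT).2 ht'.2.le⟩, ?_⟩
    have e : c (t' / T) = orbit a q₁ q₂ q₃ q₄ t := by
      rw [hc]; simp only; rw [mul_div_cancel₀ _ hT.ne', htt']
    have e1 := momentumPartial_sq_of_mem (H.orbit_mem t).1
    have e2 : 0 < (c (t' / T)).1 + 1 := by linarith [hlt (t' / T)]
    have e3 : 0 < momentumPartial a (c (t' / T)) ^ 2 := by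
      rw [e, e1, hzm, H.factor]
      have h1 : 0 < (q₂ + q₃) / 2 - q₁ := by linarith [H.lt₁₃, H.lt₁₂]
      have h2 : 0 < (q₂ + q₃) / 2 - q₂ := by linarith [H.lt₂₃]
      have h3 : 0 < q₃ - (q₂ + q₃) / 2 := by linarith [H.lt₂₃]
      have h4 : 0 < q₄ - (q₂ + q₃) / 2 := by linarith [H.lt₃₄, H.lt₂₃]
      linarith [mul_pos (mul_pos (mul_pos h1 h2) h3) h4]
    positivity

theorem isClockwiseParam_orbit {T : ℝ} (hT : 0 < T)
    (hper : Function.Periodic (orbit a q₁ q₂ q₃ q₄) T)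
    (hinj : InjOn (orbit a q₁ q₂ q₃ q₄) (Ico 0 T)) :
    IsClockwiseParam (oval a h q₂ q₃) fun s => orbit a q₁ q₂ q₃ q₄ (T * s) where
  contDiff := (contDiff_one_of_hamiltonian H.hasDerivAt_orbit).comp
    (contDiff_const.mul contDiff_id)
  periodic s := by
    simp only [mul_add, mul_one]
    exact hper _
  injOn s hs t ht hst := by
    have hm : ∀ x ∈ Ico (0 : ℝ) 1, T * x ∈ Ico 0 T := fun x hx =>
      ⟨mul_nonneg hT.le hx.1, by nlinarith [hx.2]⟩
    exact mul_left_cancel₀ hT.ne' (hinj (hm s hs) (hm t ht) hst)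
  range_eq := by
    rw [← H.range_orbit]
    exact Function.Surjective.range_comp (f := fun s => T * s)
      (fun t => ⟨t / T, mul_div_cancel₀ _ hT.ne'⟩) (orbit a q₁ q₂ q₃ q₄)
  clockwise := H.integral_momentum_pos hT hper

/-- A map acting on the orbit as a time shift has the corresponding rotation number. -/
theorem hasRotationNumber_of_shift {M : ℝ × ℝ → ℝ × ℝ} {T T' : ℝ} (hT' : 0 ≤ T') (hlt : T' < T)
    (hper : Function.Periodic (orbit a q₁ q₂ q₃ q₄) T)
    (hinj : InjOn (orbit a q₁ q₂ q₃ q₄) (Ico 0 T))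
    (hM : ∀ t, M (orbit a q₁ q₂ q₃ q₄ t) = orbit a q₁ q₂ q₃ q₄ (t + T')) :
    HasRotationNumber M (oval a h q₂ q₃) (T' / T) := by
  have hT : 0 < T := hT'.trans_lt hlt
  refine ⟨⟨div_nonneg hT' hT.le, (div_lt_one hT).2 hlt⟩, _,
    CircleDeg1Lift.translate (Multiplicative.ofAdd (T' / T)),
    H.isClockwiseParam_orbit hT hper hinj, ?_, fun s => ?_,
    CircleDeg1Lift.translationNumber_translate _⟩
  · exact continuous_const.add continuous_id
  · rw [hM, CircleDeg1Lift.translate_apply, mul_add, mul_div_cancel₀ _ hT.ne', add_comm]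

section Shift

variable (hswap : ∀ z ∈ oval a h q₂ q₃, z.swap ∈ oval a h q₂ q₃)
include hswap

theorem snd_ne_neg_one {z : ℝ × ℝ} (hz : z ∈ oval a h q₂ q₃) : z.2 ≠ -1 :=
  (H.neg_one_lt.trans_le (hswap z hz).2.1).ne'

theorem sextupoleMap_mem {z : ℝ × ℝ} (hz : z ∈ oval a h q₂ q₃) :
    sextupoleMap a z ∈ oval a h q₂ q₃ :=
  ⟨(invariant_sextupoleMap (H.snd_ne_neg_one hswap hz)).trans hz.1, (hswap z hz).2⟩

theorem sextupoleMap_orbit {T' : ℝ}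
    (h0 : sextupoleMap a (orbit a q₁ q₂ q₃ q₄ 0) = orbit a q₁ q₂ q₃ q₄ T') (t : ℝ) :
    sextupoleMap a (orbit a q₁ q₂ q₃ q₄ t) = orbit a q₁ q₂ q₃ q₄ (t + T') :=
  congrFun (hamiltonian_trajectory_unique (a := a) (K := oval a h q₂ q₃)
    (γ := fun t => sextupoleMap a (orbit a q₁ q₂ q₃ q₄ t))
    (δ := fun t => orbit a q₁ q₂ q₃ q₄ (t + T')) H.isCompact_oval
    (fun t => hasDerivAt_sextupoleMap_comp (H.hasDerivAt_orbit t)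
      (H.snd_ne_neg_one hswap (H.orbit_mem t)))
    (fun t => (H.hasDerivAt_orbit (t + T')).comp_add_const t T')
    (fun t => H.sextupoleMap_mem hswap (H.orbit_mem t))
    (fun t => H.orbit_mem _) (by simpa using h0)) t

/-- The momentum at the leftmost point lies strictly between the middle roots. -/
theorem snd_left_mem : (phasePoint a q₂ 0).2 ∈ Ioo q₂ q₃ := by
  have hz : phasePoint a q₂ 0 ∈ oval a h q₂ q₃ := H.orbit_zero ▸ H.orbit_mem 0
  have hp : (phasePoint a q₂ 0).2 ∈ Icc q₂ q₃ := (hswap _ hz).2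
  -- The image point has coordinate `p₀` and velocity `-∂H/∂q ≠ 0`, so `p₀` is not a root of the
  -- quartic.
  have h1 := momentumPartial_sq_of_mem (H.sextupoleMap_mem hswap hz).1
  rw [momentumPartial_sextupoleMap (H.snd_ne_neg_one hswap hz)] at h1
  change _ = quartic a h (phasePoint a q₂ 0).2 at h1
  have h2 := pow_pos (neg_pos.2 H.coordinatePartial_left_neg) 2
  rw [h1, H.factor] at h2
  refine ⟨lt_of_le_of_ne hp.1 fun h0 => ?_, lt_of_le_of_ne hp.2 fun h0 => ?_⟩
  · rw [← h0] at h2; simp at h2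
  · rw [h0] at h2; simp at h2

omit hswap in
theorem radicand_eq : radicand a q₁ q₂ q₃ = (q₃ - q₁) / (q₃ - q₂) *
    (((phasePoint a q₂ 0).2 - q₂) / ((phasePoint a q₂ 0).2 - q₁)) := by
  have hpos : 0 < q₂ + 1 := by linarith [H.neg_one_lt]
  rw [radicand]
  congr 1
  have e1 : (phasePoint a q₂ 0).2 - q₂ = q₂ * (3 * q₂ + 2 - a) * (-1 / (2 * (q₂ + 1))) := by
    simp only [phasePoint]; field_simp; ring
  have e2 : (phasePoint a q₂ 0).2 - q₁ =
      (2 * q₁ * (q₂ + 1) + q₂ * (q₂ - a)) * (-1 / (2 * (q₂ + 1))) := by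
    simp only [phasePoint]; field_simp; ring
  rw [e1, e2, mul_div_mul_right]
  exact div_ne_zero (by norm_num) (by positivity)

theorem radicand_mem : radicand a q₁ q₂ q₃ ∈ Ioo (0 : ℝ) 1 := by
  have hp := H.snd_left_mem hswap
  rw [H.radicand_eq]
  have h2 := sub_pos.2 H.lt₂₃
  have h3 := sub_pos.2 (H.lt₁₂.trans hp.1)
  have h4 := sub_pos.2 H.lt₁₃
  have h5 := sub_pos.2 hp.1
  refine ⟨by positivity, ?_⟩
  rw [div_mul_div_comm, div_lt_one (by positivity)]
  nlinarith [mul_pos (sub_pos.2 H.lt₁₂) (sub_pos.2 hp.2)]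

theorem orbitPhase_arcsin :
    orbitPhase a q₁ q₂ q₃ q₄ (Real.arcsin √(radicand a q₁ q₂ q₃)) =
      sextupoleMap a (phasePoint a q₂ 0) := by
  obtain ⟨hR0, hR1⟩ := H.radicand_mem hswap
  have hp := H.snd_left_mem hswap
  have hz : phasePoint a q₂ 0 ∈ oval a h q₂ q₃ := H.orbit_zero ▸ H.orbit_mem 0
  have hs1 : √(radicand a q₁ q₂ q₃) < 1 := by
    rw [Real.sqrt_lt' one_pos]; linarith
  have hs0 := Real.sqrt_pos.2 hR0
  have hsin : Real.sin (Real.arcsin √(radicand a q₁ q₂ q₃)) = √(radicand a q₁ q₂ q₃) :=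
    Real.sin_arcsin (by linarith) hs1.le
  have hcos : 0 < Real.cos (Real.arcsin √(radicand a q₁ q₂ q₃)) := by
    rw [Real.cos_arcsin]
    exact Real.sqrt_pos.2 (by rw [Real.sq_sqrt hR0.le]; linarith)
  set θ := Real.arcsin √(radicand a q₁ q₂ q₃)
  have hq : orbitCoord q₁ q₂ q₃ θ = (sextupoleMap a (phasePoint a q₂ 0)).1 :=
    H.orbitCoord_eq_of_sin_sq (H.lt₁₂.trans hp.1) (by
      rw [hsin, Real.sq_sqrt hR0.le, H.radicand_eq]; rfl)
  -- The coordinate fixes the velocity only up to sign; both velocities are positive, so the angle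
  -- is `arcsin √R` and not `π - arcsin √R`.
  have hu1 : 0 < orbitSpeed q₁ q₂ q₃ q₄ θ := by
    have hW := H.orbitDen_pos θ
    have hΔ := legendreRadical_pos H.modulus_sq_lt_one θ
    have hω := H.frequency_pos
    have hA := sub_pos.2 H.lt₁₃
    have hB := sub_pos.2 H.lt₂₃
    have hδ := sub_pos.2 H.lt₁₂
    rw [orbitSpeed, hsin]
    positivity
  have hm := H.sextupoleMap_mem hswap hz
  have hu2 : 0 < momentumPartial a (sextupoleMap a (phasePoint a q₂ 0)) := by
    rw [momentumPartial_sextupoleMap (H.snd_ne_neg_one hswap hz)]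
    exact neg_pos.2 H.coordinatePartial_left_neg
  have hu : orbitSpeed q₁ q₂ q₃ q₄ θ = momentumPartial a (sextupoleMap a (phasePoint a q₂ 0)) := by
    rw [← sq_eq_sq₀ hu1.le hu2.le, momentumPartial_sq_of_mem hm.1, H.orbitSpeed_sq, hq]
  rw [orbitPhase, hq, hu, phasePoint_momentumPartial (H.neg_one_lt.trans_le hm.2.1).ne']

end Shift

end IsRootSystem

end McMillan

theorem mainTheorem2 (a h : ℝ) (ha : |a| < 2) (hh : 0 < h) (C : Set (ℝ × ℝ))
    (hC : McMillan.IsClosedLevelCurve a h C) :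
    ∃ q₁ q₂ q₃ q₄ : ℝ,
      q₁ < q₂ ∧ q₂ < q₃ ∧ q₃ < q₄ ∧
      (∀ x : ℝ, McMillan.quartic a h x = (x - q₁) * (x - q₂) * (x - q₃) * (x - q₄)) ∧
      Prod.fst '' C = Set.Icc q₂ q₃ ∧
      (∀ z ∈ C, z.2 ≠ -1) ∧
      ∃ (γ : ℝ → ℝ × ℝ) (T T' : ℝ),
        McMillan.IsHamiltonianTrajectory a γ ∧ Set.range γ = C ∧
        IsLeast {t : ℝ | 0 < t ∧ Function.Periodic γ t} T ∧
        0 < T' ∧ T' < T ∧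
        (∀ t : ℝ, McMillan.sextupoleMap a (γ t) = γ (t + T')) ∧
        McMillan.HasRotationNumber (McMillan.sextupoleMap a) C (T' / T) ∧
        0 < McMillan.radicand a q₁ q₂ q₃ ∧ McMillan.radicand a q₁ q₂ q₃ < 1 ∧
        T' / T =
          McMillan.ellipticF (Real.arcsin (Real.sqrt (McMillan.radicand a q₁ q₂ q₃)))
              (McMillan.modulus q₁ q₂ q₃ q₄) /
            (2 * McMillan.ellipticK (McMillan.modulus q₁ q₂ q₃ q₄)) := by
  obtain ⟨q₁, q₂, q₃, q₄, H, rfl, hswap⟩ :=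
    McMillan.exists_root_system_of_isClosedLevelCurve ha hh hC
  have hk := H.modulus_sq_lt_one
  have hω := H.frequency_pos
  have hK := McMillan.ellipticK_pos hk
  obtain ⟨hR0, hR1⟩ := H.radicand_mem hswap
  have hF0 : 0 < McMillan.ellipticF (Real.arcsin √(McMillan.radicand a q₁ q₂ q₃))
      (McMillan.modulus q₁ q₂ q₃ q₄) := by
    rw [← McMillan.ellipticF_zero (McMillan.modulus q₁ q₂ q₃ q₄)]
    exact McMillan.ellipticF_strictMono hk (Real.arcsin_pos.2 (Real.sqrt_pos.2 hR0))
  have hFK : McMillan.ellipticF (Real.arcsin √(McMillan.radicand a q₁ q₂ q₃))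
      (McMillan.modulus q₁ q₂ q₃ q₄) ≤ McMillan.ellipticK (McMillan.modulus q₁ q₂ q₃ q₄) :=
    (McMillan.ellipticF_strictMono hk).monotone (Real.arcsin_le_pi_div_two _)
  have hlt : McMillan.ellipticF (Real.arcsin √(McMillan.radicand a q₁ q₂ q₃))
      (McMillan.modulus q₁ q₂ q₃ q₄) / McMillan.frequency q₁ q₂ q₃ q₄ <
      2 * McMillan.ellipticK (McMillan.modulus q₁ q₂ q₃ q₄) /
        McMillan.frequency q₁ q₂ q₃ q₄ := by
    gcongr
    linarith
  -- The orbit starts at the leftmost point with amplitude zero, so the time to reach amplitude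
  -- `arcsin √R` is `F/ω`.
  have hshift := H.sextupoleMap_orbit hswap (T' :=
    McMillan.ellipticF (Real.arcsin √(McMillan.radicand a q₁ q₂ q₃))
      (McMillan.modulus q₁ q₂ q₃ q₄) / McMillan.frequency q₁ q₂ q₃ q₄) (by
    rw [H.orbit_zero, McMillan.orbit, mul_div_cancel₀ _ hω.ne', McMillan.amplitude_ellipticF hk,
      H.orbitPhase_arcsin hswap])
  refine ⟨q₁, q₂, q₃, q₄, H.lt₁₂, H.lt₂₃, H.lt₃₄, H.factor, H.fst_image_oval,
    fun z hz => H.snd_ne_neg_one hswap hz, McMillan.orbit a q₁ q₂ q₃ q₄, _, _,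
    McMillan.isHamiltonianTrajectory_iff.2 H.hasDerivAt_orbit, H.range_orbit, H.isLeast_period,
    div_pos hF0 hω, hlt, hshift,
    H.hasRotationNumber_of_shift (div_pos hF0 hω).le hlt H.periodic_orbit H.injOn_orbit hshift,
    hR0, hR1, ?_⟩
  rw [div_div_div_cancel_right₀ hω.ne']
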